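/- Let $(A,d)$ and $(\bar A,\bar d)$ be connected commutative differential graded algebras over $\mathbb{C}$ (graded in degrees $\ge 0$, with $A^0=\bar A^0=\mathbb{C}$), both with zero differential. Let $\mathfrak{g}$ be $\mathfrak{sl}_2(\mathbb{C})$ or its Borel subalgebra $\mathfrak{sol}_2$, and let $\theta\colon\mathfrak{g}\to\mathfrak{gl}(V)$ be any representation on a finite-dimensional, non-zero $\mathbb{C}$-vector space $V$. For a connected commutative differential graded algebra $(C,d)$, let $\mathcal{F}(C,\mathfrak{g})\subseteq C^1\otimes\mathfrak{g}$ be the set of flat connections, i.e. of all $\omega$ with $\partial\omega+\tfrac12[\omega,\omega]=0$, where $\partial(a\otimes x)=da\otimes x$ and $[a\otimes x,b\otimes y]=ab\otimes[x,y]$. For $\omega=\sum_j\eta_j\otimes x_j\in\mathcal{F}(C,\mathfrak{g})$ let $d_\omega$ be the differential on $C^{\bullet}\otimes V$ given by $d_\omega(\alpha\otimes v)=d\alpha\otimes v+\sum_j\eta_j\alpha\otimes\theta(x_j)(v)$, and put $$\mathcal{R}^i_m(C,\theta)=\{\omega\in\mathcal{F}(C,\mathfrak{g})\mid \dim_{\mathbb{C}}H^i(C\otimes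 V,d_\omega)\ge m\}.$$ The tensor product $A\otimes\bar A$ is given the total grading, the product $(a\otimes\bar a)(b\otimes\bar b)=(-1)^{|\bar a||b|}ab\otimes\bar a\bar b$ and the differential $D(a\otimes\bar a)=da\otimes\bar a+(-1)^{|a|}a\otimes\bar d\bar a$; identify $(A\otimes\bar A)^1\otimes\mathfrak{g}$ with $(A^1\otimes\mathfrak{g})\times(\bar A^1\otimes\mathfrak{g})$ through $A^1\oplus\bar A^1\cong(A\otimes\bar A)^1$, $(a,\bar a)\mapsto a\otimes 1+1\otimes\bar a$. Then, for every $q\ge 0$, $$\mathcal{R}^q_1(A\otimes\bar A,\theta)=\Big(\bigcup_{i+j=q}\mathcal{R}^i_1(A,\theta)\times\mathcal{R}^j_1(\bar A,\theta)\Big)\cap\mathcal{F}(A\otimes\bar A,\mathfrak{g}).$$ -/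

import Mathlib

open scoped TensorProduct DirectSum

universe u v w

attribute [local instance 100] LieRing.ofAssociativeRing

noncomputable section

/-- A commutative differential graded algebra over `ℂ`, graded in degrees `≥ 0`:
an internally graded `ℂ`-algebra with graded-commutative multiplication and a differential
of degree `1` satisfying the graded Leibniz rule. -/
structure CDGA where
  carrier : Type u
  [ring : Ring carrier]
  [algebra : Algebra ℂ carrier]
  /-- `gr i` is the homogeneous component of degree `i`. -/
  gr : ℕ → Submodule ℂ carrier
  [graded : GradedAlgebra gr]
  graded_comm : ∀ i j : ℕ, ∀ a ∈ gr i, ∀ b ∈ gr j, a * b = (-1 : ℂ) ^ (i * j) • (b * a)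
  d : carrier →ₗ[ℂ] carrier
  d_mem : ∀ i : ℕ, ∀ a ∈ gr i, d a ∈ gr (i + 1)
  d_d : ∀ a : carrier, d (d a) = 0
  leibniz : ∀ i j : ℕ, ∀ a ∈ gr i, ∀ b ∈ gr j,
    d (a * b) = d a * b + (-1 : ℂ) ^ i • (a * d b)

namespace CDGA

instance : CoeSort CDGA.{u} (Type u) := ⟨CDGA.carrier⟩

attribute [instance] CDGA.ring CDGA.algebra CDGA.graded

/-- `A` is connected: `A⁰ = ℂ`, i.e. `c ↦ c • 1` is a bijection of `ℂ` onto `A⁰`. -/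
def IsConnected (A : CDGA.{u}) : Prop :=
  Function.Injective (algebraMap ℂ A) ∧ Set.range (algebraMap ℂ A) = (A.gr 0 : Set A)

section Tensor

/-- The grading involution `a ↦ (-1)^{|a|} a`. -/
def sgn (A : CDGA.{u}) : A →ₗ[ℂ] A :=
  (DirectSum.toModule ℂ ℕ A fun i => (-1 : ℂ) ^ i • (A.gr i).subtype) ∘ₗ
    (DirectSum.decomposeLinearEquiv A.gr).toLinearMap

theorem sgn_of_mem (A : CDGA.{u}) {i : ℕ} {a : A} (ha : a ∈ A.gr i) :
    A.sgn a = (-1 : ℂ) ^ i • a := by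
  rw [sgn, LinearMap.comp_apply, LinearEquiv.coe_coe, DirectSum.decomposeLinearEquiv_apply,
    DirectSum.decompose_of_mem A.gr ha, ← DirectSum.lof_eq_of ℂ, DirectSum.toModule_lof]
  rfl

variable (A : CDGA.{u}) (B : CDGA.{v})

/-- The underlying algebra of the tensor product: the vector space `A ⊗ B` with the
multiplication `(a ⊗ b) (a' ⊗ b') = (-1)^{|b| |a'|} a a' ⊗ b b'`. -/
abbrev TensorCarrier : Type (max u v) := GradedTensorProduct ℂ A.gr B.gr

variable {A B} in
/-- The pure tensor `a ⊗ b`. -/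
def tmul (a : A) (b : B) : TensorCarrier A B := GradedTensorProduct.of ℂ A.gr B.gr (a ⊗ₜ b)

variable {A B} in
theorem tmul_add (a : A) (b b' : B) : tmul a (b + b') = tmul a b + tmul a b' := by
  rw [tmul, TensorProduct.tmul_add, map_add]; rfl

variable {A B} in
theorem add_tmul (a a' : A) (b : B) : tmul (a + a') b = tmul a b + tmul a' b := by
  rw [tmul, TensorProduct.add_tmul, map_add]; rfl

variable {A B} in
theorem tmul_smul (c : ℂ) (a : A) (b : B) : tmul a (c • b) = c • tmul a b := by
  rw [tmul, TensorProduct.tmul_smul, map_smul]; rfl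

variable {A B} in
theorem smul_tmul (c : ℂ) (a : A) (b : B) : tmul (c • a) b = c • tmul a b := by
  rw [tmul, ← TensorProduct.smul_tmul', map_smul]; rfl

variable {A B} in
theorem tmul_zero (a : A) : tmul a (0 : B) = 0 := by
  simpa using tmul_smul (0 : ℂ) a (0 : B)

variable {A B} in
theorem zero_tmul (b : B) : tmul (0 : A) b = 0 := by
  simpa using smul_tmul (0 : ℂ) (0 : A) b

theorem tmul_mul_tmul {j i : ℕ} (a : A) {b : B} (hb : b ∈ B.gr j) {a' : A} (ha' : a' ∈ A.gr i)
    (b' : B) : tmul a b * tmul a' b' = (-1 : ℂ) ^ (j * i) • tmul (a * a') (b * b') := by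
  have h := GradedTensorProduct.tmul_coe_mul_coe_tmul (R := ℂ) A.gr B.gr a
    (⟨b, hb⟩ : B.gr j) (⟨a', ha'⟩ : A.gr i) b'
  refine h.trans ?_
  rw [Units.smul_def, ← Int.cast_smul_eq_zsmul ℂ]
  congr 1
  rcases Nat.even_or_odd (j * i) with he | ho
  · have : ((-1 : ℤˣ) ^ (j * i)) = 1 := by
      simp [he.neg_one_pow]
    rw [this, he.neg_one_pow]; simp
  · have : ((-1 : ℤˣ) ^ (j * i)) = -1 := by
      simp [ho.neg_one_pow]
    rw [this, ho.neg_one_pow]; simp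

/-- The total grading: `(A ⊗ B)^q` is the sum of the `A^i ⊗ B^j` with `i + j = q`. -/
def tensorGr (q : ℕ) : Submodule ℂ (TensorCarrier A B) :=
  Submodule.span ℂ {x | ∃ i j : ℕ, i + j = q ∧ ∃ a ∈ A.gr i, ∃ b ∈ B.gr j, x = tmul a b}

/-- The differential `D (a ⊗ b) = d a ⊗ b + (-1)^{|a|} a ⊗ d b`. -/
def tensorD : TensorCarrier A B →ₗ[ℂ] TensorCarrier A B :=
  (GradedTensorProduct.of ℂ A.gr B.gr).toLinearMap ∘ₗ
    (TensorProduct.map A.d LinearMap.id + TensorProduct.map A.sgn B.d) ∘ₗ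
      (GradedTensorProduct.of ℂ A.gr B.gr).symm.toLinearMap

variable {A B}

theorem tmul_mem {i j q : ℕ} (h : i + j = q) {a : A} (ha : a ∈ A.gr i) {b : B}
    (hb : b ∈ B.gr j) : tmul a b ∈ tensorGr A B q :=
  Submodule.subset_span ⟨i, j, h, a, ha, b, hb, rfl⟩

theorem tensorGr_induction {q : ℕ} {S : Submodule ℂ (TensorCarrier A B)}
    (h : ∀ i j : ℕ, i + j = q → ∀ a ∈ A.gr i, ∀ b ∈ B.gr j, tmul a b ∈ S)
    {x : TensorCarrier A B} (hx : x ∈ tensorGr A B q) : x ∈ S := by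
  refine (Submodule.span_le (p := S)).2 ?_ hx
  rintro _ ⟨i, j, hij, a, ha, b, hb, rfl⟩
  exact h i j hij a ha b hb

theorem tensor_induction {S : Submodule ℂ (TensorCarrier A B)}
    (h : ∀ i j : ℕ, ∀ a ∈ A.gr i, ∀ b ∈ B.gr j, tmul a b ∈ S)
    (x : TensorCarrier A B) : x ∈ S := by
  have hpure : ∀ (a : A) (b : B), tmul a b ∈ S := by
    intro a b
    induction a using DirectSum.Decomposition.inductionOn A.gr with
    | zero => rw [zero_tmul]; exact S.zero_mem
    | homogeneous a =>
      induction b using DirectSum.Decomposition.inductionOn B.gr with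
      | zero => rw [tmul_zero]; exact S.zero_mem
      | homogeneous b => exact h _ _ _ a.2 _ b.2
      | add b b' hb hb' =>
        rw [tmul_add]; exact S.add_mem hb hb'
    | add a a' ha ha' =>
      rw [add_tmul]; exact S.add_mem ha ha'
  have key : ∀ y : A ⊗[ℂ] B, GradedTensorProduct.of ℂ A.gr B.gr y ∈ S := by
    intro y
    induction y using TensorProduct.induction_on with
    | zero => simp
    | tmul a b => exact hpure a b
    | add y z hy hz => simpa using S.add_mem hy hz
  exact key ((GradedTensorProduct.of ℂ A.gr B.gr).symm x)

theorem tensorD_tmul {i : ℕ} {a : A} (ha : a ∈ A.gr i) (b : B) :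
    tensorD A B (tmul a b) = tmul (A.d a) b + (-1 : ℂ) ^ i • tmul a (B.d b) := by
  have h : tensorD A B (tmul a b) = tmul (A.d a) b + tmul (A.sgn a) (B.d b) := rfl
  rw [h, sgn_of_mem A ha, smul_tmul]

variable (A B) in
/-- The decomposition of `A ⊗ B` into its homogeneous components. -/
def tensorDecompose : TensorCarrier A B →ₗ[ℂ] ⨁ q, tensorGr A B q :=
  TensorProduct.lift
    (((DirectSum.toModule ℂ ℕ ((⨁ j, B.gr j) →ₗ[ℂ] ⨁ q, tensorGr A B q) fun i =>
      LinearMap.flip (DirectSum.toModule ℂ ℕ (A.gr i →ₗ[ℂ] ⨁ q, tensorGr A B q) fun j =>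
        LinearMap.mk₂ ℂ (fun (b : B.gr j) (a : A.gr i) =>
            DirectSum.lof ℂ ℕ (fun q => tensorGr A B q) (i + j)
              ⟨tmul (a : A) (b : B), tmul_mem rfl a.2 b.2⟩)
          (fun b b' a => by
            rw [← map_add]; exact congrArg _ (Subtype.ext (tmul_add _ _ _)))
          (fun c b a => by
            rw [← map_smul]; exact congrArg _ (Subtype.ext (tmul_smul _ _ _)))
          (fun b a a' => by
            rw [← map_add]; exact congrArg _ (Subtype.ext (add_tmul _ _ _)))
          (fun c b a => by
            rw [← map_smul]; exact congrArg _ (Subtype.ext (smul_tmul _ _ _)))))).compl₁₂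
      (DirectSum.decomposeLinearEquiv A.gr).toLinearMap
      (DirectSum.decomposeLinearEquiv B.gr).toLinearMap) ∘ₗ
    (GradedTensorProduct.of ℂ A.gr B.gr).symm.toLinearMap

theorem tensorDecompose_tmul {i j : ℕ} {a : A} (ha : a ∈ A.gr i) {b : B} (hb : b ∈ B.gr j) :
    tensorDecompose A B (tmul a b) =
      DirectSum.lof ℂ ℕ (fun q => tensorGr A B q) (i + j) ⟨tmul a b, tmul_mem rfl ha hb⟩ := by
  rw [tensorDecompose, LinearMap.comp_apply, LinearEquiv.coe_coe]
  simp only [tmul]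
  rw [GradedTensorProduct.of_symm_of, TensorProduct.lift.tmul, LinearMap.compl₁₂_apply,
    LinearEquiv.coe_coe, LinearEquiv.coe_coe, DirectSum.decomposeLinearEquiv_apply,
    DirectSum.decomposeLinearEquiv_apply, DirectSum.decompose_of_mem A.gr ha,
    DirectSum.decompose_of_mem B.gr hb, ← DirectSum.lof_eq_of ℂ, ← DirectSum.lof_eq_of ℂ,
    DirectSum.toModule_lof, LinearMap.flip_apply, DirectSum.toModule_lof]
  rfl

theorem tensorDecompose_of_mem {q : ℕ} {x : TensorCarrier A B} (hx : x ∈ tensorGr A B q) :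
    tensorDecompose A B x = DirectSum.lof ℂ ℕ (fun q => tensorGr A B q) q ⟨x, hx⟩ := by
  induction hx using Submodule.span_induction with
  | mem x h =>
    obtain ⟨i, j, rfl, a, ha, b, hb, rfl⟩ := h
    exact tensorDecompose_tmul ha hb
  | zero => rw [map_zero]; exact (map_zero _).symm
  | add x y hx hy h1 h2 => rw [map_add, h1, h2, ← map_add]; rfl
  | smul c x hx h1 => rw [map_smul, h1, ← map_smul]; rfl

instance tensorGraded : GradedAlgebra (tensorGr A B) where
  one_mem := tmul_mem (A := A) (B := B) (add_zero 0) (SetLike.one_mem_graded A.gr)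
    (SetLike.one_mem_graded B.gr)
  mul_mem := by
    intro p q x y hx hy
    refine tensorGr_induction (S := (tensorGr A B (p + q)).comap (LinearMap.mulRight ℂ y)) ?_ hx
    intro i j hij a ha b hb
    refine tensorGr_induction
      (S := (tensorGr A B (p + q)).comap (LinearMap.mulLeft ℂ (tmul a b))) ?_ hy
    intro k l hkl a' ha' b' hb'
    change tmul a b * tmul a' b' ∈ tensorGr A B (p + q)
    rw [tmul_mul_tmul A B a hb ha' b']
    exact Submodule.smul_mem _ _ (tmul_mem (by omega) (SetLike.GradedMul.mul_mem ha ha')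
      (SetLike.GradedMul.mul_mem hb hb'))
  toDecomposition := DirectSum.Decomposition.ofLinearMap _ (tensorDecompose A B)
    (by
      refine LinearMap.ext fun x => ?_
      refine tensor_induction (A := A) (B := B) (S := LinearMap.eqLocus
        (DirectSum.coeLinearMap (tensorGr A B) ∘ₗ tensorDecompose A B) LinearMap.id) ?_ x
      intro i j a ha b hb
      rw [LinearMap.mem_eqLocus, LinearMap.comp_apply, tensorDecompose_tmul ha hb]
      simp)
    (by
      ext q ⟨x, hx⟩ : 2
      simp [tensorDecompose_of_mem hx])

end Tensor

/-- The tensor product of two cdga's. -/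
def tensor (A : CDGA.{u}) (B : CDGA.{v}) : CDGA.{max u v} where
  carrier := TensorCarrier A B
  gr := tensorGr A B
  graded_comm := by
    intro p q x hx y hy
    refine tensorGr_induction (S := LinearMap.eqLocus (LinearMap.mulRight ℂ y)
      ((-1 : ℂ) ^ (p * q) • LinearMap.mulLeft ℂ y)) ?_ hx
    intro i j hij a ha b hb
    refine tensorGr_induction (S := LinearMap.eqLocus (LinearMap.mulLeft ℂ (tmul a b))
      ((-1 : ℂ) ^ (p * q) • LinearMap.mulRight ℂ (tmul a b))) ?_ hy
    intro k l hkl a' ha' b' hb'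
    change tmul a b * tmul a' b' = (-1 : ℂ) ^ (p * q) • (tmul a' b' * tmul a b)
    rw [tmul_mul_tmul A B a hb ha' b', tmul_mul_tmul A B a' hb' ha b,
      A.graded_comm i k a ha a' ha', B.graded_comm j l b hb b' hb']
    simp only [tmul_smul, smul_tmul, smul_smul, ← pow_add, ← hij, ← hkl]
    congr 1
    have h : ∀ m n : ℕ, Even (m + n) → (-1 : ℂ) ^ m = (-1 : ℂ) ^ n := by
      intro m n hmn
      rcases Nat.even_or_odd m with hm | hm
      · rw [hm.neg_one_pow, ((Nat.even_add.1 hmn).1 hm).neg_one_pow]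
      · have hn : Odd n := by
          rw [← Nat.not_even_iff_odd] at hm ⊢
          exact fun h => hm ((Nat.even_add.1 hmn).2 h)
        rw [hm.neg_one_pow, hn.neg_one_pow]
    apply h
    exact ⟨j * k + i * k + j * l + i * l, by ring⟩
  d := tensorD A B
  d_mem := by
    intro q x hx
    refine tensorGr_induction (S := (tensorGr A B (q + 1)).comap (tensorD A B)) ?_ hx
    intro i j hij a ha b hb
    rw [Submodule.mem_comap, tensorD_tmul ha]
    exact Submodule.add_mem _ (tmul_mem (by omega) (A.d_mem i a ha) hb)
      (Submodule.smul_mem _ _ (tmul_mem (by omega) ha (B.d_mem j b hb)))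
  d_d := by
    intro x
    refine tensor_induction (S := LinearMap.ker (tensorD A B ∘ₗ tensorD A B)) ?_ x
    intro i j a ha b hb
    rw [LinearMap.mem_ker, LinearMap.comp_apply, tensorD_tmul ha, map_add, map_smul,
      tensorD_tmul ha, tensorD_tmul (A.d_mem i a ha), A.d_d, B.d_d]
    simp [pow_succ, tmul_zero, zero_tmul]
  leibniz := by
    intro p q x hx y hy
    refine tensorGr_induction (S := LinearMap.eqLocus (tensorD A B ∘ₗ LinearMap.mulRight ℂ y)
      (LinearMap.mulRight ℂ y ∘ₗ tensorD A B +
        (-1 : ℂ) ^ p • LinearMap.mulRight ℂ (tensorD A B y))) ?_ hx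
    intro i j hij a ha b hb
    refine tensorGr_induction (S := LinearMap.eqLocus
      (tensorD A B ∘ₗ LinearMap.mulLeft ℂ (tmul a b))
      (LinearMap.mulLeft ℂ (tensorD A B (tmul a b)) +
        (-1 : ℂ) ^ p • LinearMap.mulLeft ℂ (tmul a b) ∘ₗ tensorD A B)) ?_ hy
    intro k l hkl a' ha' b' hb'
    change tensorD A B (tmul a b * tmul a' b') = tensorD A B (tmul a b) * tmul a' b' +
      (-1 : ℂ) ^ p • (tmul a b * tensorD A B (tmul a' b'))
    rw [tmul_mul_tmul A B a hb ha' b', map_smul,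
      tensorD_tmul (SetLike.GradedMul.mul_mem ha ha'), tensorD_tmul ha, tensorD_tmul ha',
      A.leibniz i k a ha a' ha', B.leibniz j l b hb b' hb', add_mul, mul_add,
      smul_mul_assoc, mul_smul_comm, tmul_mul_tmul A B _ hb ha' b',
      tmul_mul_tmul A B _ (B.d_mem j b hb) ha' b',
      tmul_mul_tmul A B _ hb (A.d_mem k a' ha') b', tmul_mul_tmul A B _ hb ha' _, ← hij]
    have h2 : ∀ n : ℕ, ((-1 : ℂ) ^ n) * (-1 : ℂ) ^ n = 1 := by
      intro n; rw [← mul_pow]; simp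
    simp only [tmul_add, add_tmul, tmul_smul, smul_tmul, smul_add, smul_smul]
    have e1 : (-1 : ℂ) ^ (j * k) * (-1) ^ i =
        (-1) ^ (i + j) * (-1) ^ (j * (k + 1)) := by
      have := h2 j
      rw [pow_add, mul_add, pow_add, mul_one]
      linear_combination (-(-1 : ℂ) ^ (j * k) * (-1) ^ i) * this
    have e2 : (-1 : ℂ) ^ (j * k) * (-1) ^ (i + k) = (-1) ^ i * (-1) ^ ((j + 1) * k) := by
      ring
    have e3 : (-1 : ℂ) ^ (j * k) * ((-1) ^ (i + k) * (-1) ^ j) =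
        (-1) ^ (i + j) * ((-1) ^ k * (-1) ^ (j * k)) := by
      ring
    simp only [e1, e2, e3]
    abel

section Connections

variable (A : CDGA.{u})

/-- The inclusion `A^i ⊗ W → A ⊗ W`. -/
def incl (i : ℕ) (W : Type w) [AddCommGroup W] [Module ℂ W] : A.gr i ⊗[ℂ] W →ₗ[ℂ] A ⊗[ℂ] W :=
  (A.gr i).subtype.rTensor W

variable (g : Type w) [LieRing g] [LieAlgebra ℂ g]

/-- The bracket `[a ⊗ x, b ⊗ y] = a b ⊗ [x, y]` on `A ⊗ g`. -/
def bracket : A ⊗[ℂ] g →ₗ[ℂ] A ⊗[ℂ] g →ₗ[ℂ] A ⊗[ℂ] g :=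
  TensorProduct.map₂ (LinearMap.mul ℂ A) (LieModule.toEnd ℂ g g : g →ₗ[ℂ] Module.End ℂ g)

/-- The differential `∂ (a ⊗ x) = d a ⊗ x` on `A ⊗ g`. -/
def partialD : A ⊗[ℂ] g →ₗ[ℂ] A ⊗[ℂ] g := A.d.rTensor g

/-- The set `F(A, g) ⊆ A^1 ⊗ g` of flat `g`-valued connections: the solutions of the
Maurer-Cartan equation `∂ ω + [ω, ω] / 2 = 0`. -/
def flatConnections : Set (A.gr 1 ⊗[ℂ] g) :=
  {ω | A.partialD g (A.incl 1 g ω) +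
    (1 / 2 : ℂ) • A.bracket g (A.incl 1 g ω) (A.incl 1 g ω) = 0}

variable {g} {V : Type*} [AddCommGroup V] [Module ℂ V] (θ : g →ₗ⁅ℂ⁆ Module.End ℂ V)

/-- The covariant derivative on `A ⊗ V`: if `ω = ∑ η_j ⊗ x_j` then
`d_ω (α ⊗ v) = d α ⊗ v + ∑ η_j α ⊗ θ(x_j) v`. -/
def covDeriv (ω : A.gr 1 ⊗[ℂ] g) : A ⊗[ℂ] V →ₗ[ℂ] A ⊗[ℂ] V :=
  A.d.rTensor V +
    TensorProduct.map₂ (LinearMap.mul ℂ A) (θ : g →ₗ[ℂ] Module.End ℂ V) (A.incl 1 g ω)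

/-- The cocycles of degree `i` of the complex `(A ⊗ V, d_ω)`. -/
def cocycles (ω : A.gr 1 ⊗[ℂ] g) (i : ℕ) : Submodule ℂ (A ⊗[ℂ] V) :=
  LinearMap.range (A.incl i V) ⊓ LinearMap.ker (A.covDeriv θ ω)

/-- The coboundaries of degree `i` of the complex `(A ⊗ V, d_ω)`. -/
def coboundaries (ω : A.gr 1 ⊗[ℂ] g) : ℕ → Submodule ℂ (A ⊗[ℂ] V)
  | 0 => ⊥
  | i + 1 => (LinearMap.range (A.incl i V)).map (A.covDeriv θ ω)

/-- The cohomology `H^i(A ⊗ V, d_ω)`. -/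
abbrev Cohomology (ω : A.gr 1 ⊗[ℂ] g) (i : ℕ) : Type _ :=
  A.cocycles θ ω i ⧸ (A.coboundaries θ ω i).submoduleOf (A.cocycles θ ω i)

/-- The resonance variety `R^i_m(A, θ)`: the flat connections `ω` for which
`H^i(A ⊗ V, d_ω)` has dimension at least `m`. -/
def resonance (i m : ℕ) : Set (A.gr 1 ⊗[ℂ] g) :=
  {ω | ω ∈ A.flatConnections g ∧ (m : Cardinal) ≤ Module.rank ℂ (A.Cohomology θ ω i)}

end Connections

section Product

variable (A : CDGA.{u}) (B : CDGA.{v})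

/-- The inclusion `A^1 → (A ⊗ B)^1`, `a ↦ a ⊗ 1`. -/
def inclLeft : A.gr 1 →ₗ[ℂ] (A.tensor B).gr 1 where
  toFun a := ⟨tmul (a : A) (1 : B), tmul_mem (add_zero 1) a.2 (SetLike.one_mem_graded B.gr)⟩
  map_add' _ _ := Subtype.ext (add_tmul _ _ _)
  map_smul' _ _ := Subtype.ext (smul_tmul _ _ _)

/-- The inclusion `B^1 → (A ⊗ B)^1`, `b ↦ 1 ⊗ b`. -/
def inclRight : B.gr 1 →ₗ[ℂ] (A.tensor B).gr 1 where
  toFun b := ⟨tmul (1 : A) (b : B), tmul_mem (zero_add 1) (SetLike.one_mem_graded A.gr) b.2⟩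
  map_add' _ _ := Subtype.ext (tmul_add _ _ _)
  map_smul' _ _ := Subtype.ext (tmul_smul _ _ _)

/-- The canonical map `(ω, ω') ↦ ω + ω'` from `(A^1 ⊗ g) × (B^1 ⊗ g)` to `(A ⊗ B)^1 ⊗ g`
(an isomorphism when `A` and `B` are connected). -/
def addConn (g : Type w) [AddCommGroup g] [Module ℂ g] :
    (A.gr 1 ⊗[ℂ] g) × (B.gr 1 ⊗[ℂ] g) →ₗ[ℂ] (A.tensor B).gr 1 ⊗[ℂ] g :=
  ((inclLeft A B).rTensor g).coprod ((inclRight A B).rTensor g)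

end Product

end CDGA

/-- The Lie algebra `sl_2` of traceless complex `2 × 2` matrices. -/
abbrev sl2 : LieSubalgebra ℂ (Matrix (Fin 2) (Fin 2) ℂ) :=
  LieAlgebra.SpecialLinear.sl (Fin 2) ℂ

/-- The Borel subalgebra `sol_2` of `sl_2`: the upper triangular traceless matrices. -/
def sol2 : LieSubalgebra ℂ (Matrix (Fin 2) (Fin 2) ℂ) where
  carrier := {M | M ∈ sl2 ∧ M 1 0 = 0}
  zero_mem' := ⟨sl2.zero_mem, rfl⟩
  add_mem' := fun {M N} hM hN => ⟨sl2.add_mem hM.1 hN.1, by simp [hM.2, hN.2]⟩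
  smul_mem' := fun c {M} hM => ⟨sl2.smul_mem c hM.1, by simp [hM.2]⟩
  lie_mem' := fun {M N} hM hN => ⟨sl2.lie_mem hM.1 hN.1, by
    have h1 := hM.2
    have h2 := hN.2
    simp [Ring.lie_def, Matrix.mul_apply, Fin.sum_univ_two, h1, h2]⟩

end

/-! For depth one only nonvanishing of cohomology matters. A homogeneous element is a coboundary as
soon as it lies in the range of the differential, so `HasClass` can quotient by the whole range, and
`mem_resonance_one_iff` turns resonance into flatness plus `HasClass`.

With zero differentials, flatness of `ω + ω'` has components in `A² ⊗ 1`, `A¹ ⊗ B¹` and `1 ⊗ B²`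
(`bracket_addConn`). The outer two say that `ω` and `ω'` are flat. The middle one says that every
contraction of `ω` commutes with every contraction of `ω'` (`lie_contract_eq_zero`). In `sl2` and
`sol2` the centralizer of a nonzero element is a line (`mem_span_of_lie_eq_zero`), so `ω = 0`, or
`ω' = 0`, or `ω = η ⊗ x` and `ω' = η' ⊗ x` for one common `x` (`commuting_cases`).

In each case the nonvanishing degrees add, by a Künneth argument (`hasClass_tensor_iff`). If one
connection is zero, the coefficients `V` are attached to the other factor and the twisted complex is
an honest tensor product of complexes. On a common line the differential is multiplication by `η`
tensored with `T = θ x`. If `T` is bijective it does not affect nonvanishing, and Künneth applies to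
multiplication by `η` and by `η'`. If `T` is singular, `H^i(A ⊗ V)` is nonzero exactly when `A^i ≠
0`, whatever `η` is (`hasClass_map_of_not_injective`), and the claim becomes the same Künneth
statement for zero differentials. -/

/-! ### Künneth for nonvanishing of cohomology -/

section Kunneth

variable {K L : Type*} [AddCommGroup K] [Module ℂ K] [AddCommGroup L] [Module ℂ L]

/-- The cochains in `S` carry a nonzero cohomology class of the differential `d`. -/
def HasClass (d : K →ₗ[ℂ] K) (S : Submodule ℂ K) : Prop :=
  ∃ z ∈ S, d z = 0 ∧ z ∉ LinearMap.range d

/-- The degree `q` part of the tensor product of two graded vector spaces. -/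
def totalGr (gr : ℕ → Submodule ℂ K) (gr' : ℕ → Submodule ℂ L) (q : ℕ) :
    Submodule ℂ (K ⊗[ℂ] L) :=
  Submodule.span ℂ {x | ∃ i j : ℕ, i + j = q ∧ ∃ a ∈ gr i, ∃ b ∈ gr' j, x = a ⊗ₜ b}

theorem hasClass_equiv (e : K ≃ₗ[ℂ] L) {d : K →ₗ[ℂ] K} {d' : L →ₗ[ℂ] L}
    (hd : ∀ x, e (d x) = d' (e x)) (S : Submodule ℂ K) :
    HasClass d S ↔ HasClass d' (S.map e.toLinearMap) := by
  constructor
  · rintro ⟨z, hz, hdz, hn⟩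
    refine ⟨e z, Submodule.mem_map_of_mem hz, by rw [← hd, hdz, map_zero], ?_⟩
    rintro ⟨y, hy⟩
    exact hn ⟨e.symm y, e.injective (by rw [hd, e.apply_symm_apply, hy])⟩
  · rintro ⟨_, ⟨z, hz, rfl⟩, hdz, hn⟩
    refine ⟨z, hz, e.injective (by rw [hd, map_zero]; exact hdz), ?_⟩
    rintro ⟨y, rfl⟩
    exact hn ⟨e y, (hd y).symm⟩

theorem exists_functional_of_notMem_range {d : K →ₗ[ℂ] K} {z : K} (hz : z ∉ LinearMap.range d) :
    ∃ f : K →ₗ[ℂ] ℂ, f z = 1 ∧ ∀ y, f (d y) = 0 := by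
  obtain ⟨f, hf, hf'⟩ := Submodule.exists_le_ker_of_notMem hz
  refine ⟨(f z)⁻¹ • f, by simp [hf], fun y => ?_⟩
  have : f (d y) = 0 := hf' ⟨y, rfl⟩
  simp [this]

theorem eqOn_of_homogeneous {L : Type*} [AddCommMonoid L] [Module ℂ L]
    {gr : ℕ → Submodule ℂ K} [DirectSum.Decomposition gr]
    {f f' : K →ₗ[ℂ] L} (h : ∀ i, ∀ a ∈ gr i, f a = f' a) (a : K) : f a = f' a := by
  induction a using DirectSum.Decomposition.inductionOn gr with
  | zero => simp
  | homogeneous a => exact h _ _ a.2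
  | add a b ha hb => rw [map_add, map_add, ha, hb]

/-- A degreewise defined linear map on a graded vector space. -/
theorem exists_linearMap_of_components {L : Type*} [AddCommMonoid L] [Module ℂ L]
    (gr : ℕ → Submodule ℂ K) [DirectSum.Decomposition gr]
    (f : ∀ i, gr i →ₗ[ℂ] L) : ∃ F : K →ₗ[ℂ] L, ∀ i (a : gr i), F a = f i a := by
  refine ⟨DirectSum.toModule ℂ ℕ L f ∘ₗ (DirectSum.decomposeLinearEquiv gr).toLinearMap,
    fun i a => ?_⟩
  rw [LinearMap.comp_apply, LinearEquiv.coe_coe, DirectSum.decomposeLinearEquiv_apply,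
    DirectSum.decompose_coe, ← DirectSum.lof_eq_of ℂ, DirectSum.toModule_lof]

/-- Over a field, `f` has a section on its range, and the section extends to all of `L`. -/
theorem exists_generalizedInverse (f : K →ₗ[ℂ] L) : ∃ r : L →ₗ[ℂ] K, ∀ a, f (r (f a)) = f a := by
  obtain ⟨r, hr⟩ := f.rangeRestrict.exists_rightInverse_of_surjective f.range_rangeRestrict
  obtain ⟨r', hr'⟩ := r.exists_extend
  refine ⟨r', fun a => ?_⟩
  have h1 : r' (f a) = r (f.rangeRestrict a) := LinearMap.congr_fun hr' (f.rangeRestrict a)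
  rw [h1]
  exact congrArg Subtype.val (LinearMap.congr_fun hr (f.rangeRestrict a))

theorem exists_homotopy (gr : ℕ → Submodule ℂ K) [DirectSum.Decomposition gr]
    (d : K →ₗ[ℂ] K) (hd : ∀ i, ∀ a ∈ gr i, d a ∈ gr (i + 1)) :
    ∃ h : K →ₗ[ℂ] K, (∀ a ∈ gr 0, h a = 0) ∧ (∀ i, ∀ a ∈ gr (i + 1), h a ∈ gr i) ∧
      ∀ a, d (h (d a)) = d a := by
  choose r hr using fun i => exists_generalizedInverse (d ∘ₗ (gr i).subtype)
  obtain ⟨h, hh⟩ := exists_linearMap_of_components gr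
    (fun i => Nat.casesOn (motive := fun i => gr i →ₗ[ℂ] K) i 0
      fun j => (gr j).subtype ∘ₗ r j ∘ₗ (gr (j + 1)).subtype)
  refine ⟨h, fun a ha => hh 0 ⟨a, ha⟩, fun i a ha => ?_,
    eqOn_of_homogeneous (gr := gr) (f := d ∘ₗ h ∘ₗ d) fun i a ha => ?_⟩
  · rw [hh (i + 1) ⟨a, ha⟩]
    exact (r i a).2
  · have h1 : h (d a) = r i (d a) := hh (i + 1) ⟨d a, hd i a ha⟩
    change d (h (d a)) = d a
    rw [h1]
    exact hr i ⟨a, ha⟩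

/-- A homotopy from the identity to a map `P` that sees only cohomology. With `d h d = d`, the map
`1 - d h - h d` lands in cocycles and kills coboundaries, but it need not vanish in acyclic degrees.
-/
theorem exists_homotopy_projection (gr : ℕ → Submodule ℂ K) [DirectSum.Decomposition gr]
    (d : K →ₗ[ℂ] K) (hd : ∀ i, ∀ a ∈ gr i, d a ∈ gr (i + 1)) (hdd : ∀ a, d (d a) = 0) :
    ∃ h P : K →ₗ[ℂ] K, (∀ a ∈ gr 0, h a = 0) ∧ (∀ i, ∀ a ∈ gr (i + 1), h a ∈ gr i) ∧
      (∀ i, ∀ a ∈ gr i, P a ∈ gr i) ∧ (∀ a, d (P a) = 0) ∧ (∀ a, P (d a) = 0) ∧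
      (∀ a, d (h a) + h (d a) = a - P a) ∧
      ∀ i, ¬ HasClass d (gr i) → ∀ a ∈ gr i, P a = 0 := by
  obtain ⟨h, h0, h1, h2⟩ := exists_homotopy gr d hd
  set P : K →ₗ[ℂ] K := LinearMap.id - d ∘ₗ h - h ∘ₗ d with hP
  have hPa : ∀ a, P a = a - d (h a) - h (d a) := fun a => rfl
  have hdP : ∀ a, d (P a) = 0 := fun a => by simp [hPa, hdd, h2]
  have hPd : ∀ a, P (d a) = 0 := fun a => by simp [hPa, hdd, h2]
  have hPg : ∀ i, ∀ a ∈ gr i, P a ∈ gr i := by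
    intro i a ha
    rw [hPa]
    refine Submodule.sub_mem _ (Submodule.sub_mem _ ha ?_) (h1 i _ (hd i a ha))
    cases i with
    | zero => rw [h0 a ha, map_zero]; exact Submodule.zero_mem _
    | succ i => exact hd i _ (h1 i a ha)
  -- Squaring repairs this: in an acyclic degree `P a` is a coboundary, so `P (P a) = 0`. The
  -- homotopy changes to `h (1 + P)` because `1 - P² = (1 - P)(1 + P)`, with `P d = 0`.
  refine ⟨h ∘ₗ (LinearMap.id + P), P ∘ₗ P, ?_, ?_, ?_, ?_, ?_, ?_, ?_⟩
  · exact fun a ha => h0 _ (Submodule.add_mem _ ha (hPg 0 a ha))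
  · exact fun i a ha => h1 _ _ (Submodule.add_mem _ ha (hPg _ a ha))
  · exact fun i a ha => hPg _ _ (hPg _ _ ha)
  · exact fun a => hdP _
  · intro a; simp [hPd]
  · intro a
    have e1 := hPa a
    have e2 := hPa (P a)
    simp only [LinearMap.comp_apply, LinearMap.add_apply, LinearMap.id_apply, map_add, hPd,
      hdP, map_zero, add_zero, sub_zero] at e1 e2 ⊢
    rw [e2]
    nth_rewrite 2 [e1]
    abel
  · intro i hi a ha
    have : P a ∈ LinearMap.range d := by
      by_contra hn
      exact hi ⟨P a, hPg i a ha, hdP a, hn⟩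
    obtain ⟨y, hy⟩ := this
    rw [LinearMap.comp_apply, ← hy, hPd]

/-- Forward: the identity is homotopic to `P ⊗ P'`, which vanishes in total degree `q` when no pair
of degrees carries classes. Backward: the class of `a ⊗ b` is detected by a product of functionals
vanishing on coboundaries. -/
theorem hasClass_tensor_iff (gr : ℕ → Submodule ℂ K) [DirectSum.Decomposition gr]
    (d : K →ₗ[ℂ] K) (hd : ∀ i, ∀ a ∈ gr i, d a ∈ gr (i + 1)) (hdd : ∀ a, d (d a) = 0)
    (gr' : ℕ → Submodule ℂ L) [DirectSum.Decomposition gr']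
    (d' : L →ₗ[ℂ] L) (hd' : ∀ i, ∀ a ∈ gr' i, d' a ∈ gr' (i + 1)) (hdd' : ∀ a, d' (d' a) = 0)
    (s : K →ₗ[ℂ] K) (hs : ∀ i, ∀ a ∈ gr i, s a = (-1 : ℂ) ^ i • a) (q : ℕ) :
    HasClass (TensorProduct.map d LinearMap.id + TensorProduct.map s d') (totalGr gr gr' q) ↔
      ∃ i j, i + j = q ∧ HasClass d (gr i) ∧ HasClass d' (gr' j) := by
  constructor
  · rintro ⟨z, hz, hDz, hn⟩
    by_contra! hcon
    apply hn
    obtain ⟨h, P, h0, h1, hPg, hdP, hPd, hP, hP0⟩ := exists_homotopy_projection gr d hd hdd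
    obtain ⟨h', P', -, -, -, -, -, hP', hP0'⟩ := exists_homotopy_projection gr' d' hd' hdd'
    have hss : ∀ a, s (s a) = a := eqOn_of_homogeneous (gr := gr) (f := s ∘ₗ s)
      (f' := LinearMap.id) fun i a ha => by
        simp [hs i a ha, smul_smul, ← mul_pow]
    have hsh : ∀ a, s (h a) = - h (s a) := eqOn_of_homogeneous (gr := gr) (f := s ∘ₗ h)
      (f' := - h ∘ₗ s) fun i a ha => by
        cases i with
        | zero => simp [hs 0 a ha, h0 a ha]
        | succ i => simp [hs _ a ha, hs i _ (h1 i a ha), pow_succ]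
    have hsP : ∀ a, s (P (s a)) = P a := eqOn_of_homogeneous (gr := gr) (f := s ∘ₗ P ∘ₗ s)
      fun i a ha => by
        simp [hs i a ha, hs i _ (hPg i a ha), smul_smul, ← mul_pow]
    have hds : ∀ a, d (s (P a)) = 0 := eqOn_of_homogeneous (gr := gr) (f := d ∘ₗ s ∘ₗ P)
      (f' := 0) fun i a ha => by
        simp [hs i _ (hPg i a ha), hdP]
    set D := TensorProduct.map d LinearMap.id + TensorProduct.map s d' with hD
    -- The standard tensor homotopy: contract the first factor to `P`, then the second to `P'`. The
    -- involution `s` supplies the Koszul sign in the second term.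
    set H := TensorProduct.map h LinearMap.id + TensorProduct.map (s ∘ₗ P) h' with hH
    have key : ∀ x, D (H x) + H (D x) = x - TensorProduct.map P P' x := by
      intro x
      refine LinearMap.congr_fun (f := D ∘ₗ H + H ∘ₗ D)
        (g := LinearMap.id - TensorProduct.map P P') (TensorProduct.ext' fun a b => ?_) x
      have e1 : a - P a = d (h a) + h (d a) := (hP a).symm
      have e2 : b - P' b = d' (h' b) + h' (d' b) := (hP' b).symm
      have e3 : a ⊗ₜ[ℂ] b - P a ⊗ₜ[ℂ] P' b =
          d (h a) ⊗ₜ b + h (d a) ⊗ₜ b + (P a ⊗ₜ d' (h' b) + P a ⊗ₜ h' (d' b)) := by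
        rw [← TensorProduct.add_tmul, ← TensorProduct.tmul_add, ← e1, ← e2,
          TensorProduct.sub_tmul, TensorProduct.tmul_sub]
        abel
      simp only [hD, hH, LinearMap.add_apply, LinearMap.comp_apply, LinearMap.sub_apply,
        TensorProduct.map_tmul, LinearMap.id_apply, map_add, hss, hsh, hsP, hds, hPd, e3,
        map_zero, TensorProduct.zero_tmul, TensorProduct.neg_tmul]
      abel
    have hPz : TensorProduct.map P P' z = 0 := by
      refine (Submodule.span_le (p := LinearMap.ker (TensorProduct.map P P'))).2 ?_ hz
      rintro _ ⟨i, j, hij, a, ha, b, hb, rfl⟩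
      by_cases hi : HasClass d (gr i)
      · simp [hP0' j (hcon i j hij hi) b hb]
      · simp [hP0 i hi a ha]
    refine ⟨H z, ?_⟩
    simpa [hDz, hPz] using key z
  · rintro ⟨i, j, hij, ⟨a, ha, hda, hna⟩, ⟨b, hb, hdb, hnb⟩⟩
    refine ⟨a ⊗ₜ b, Submodule.subset_span ⟨i, j, hij, a, ha, b, hb, rfl⟩, by simp [hda, hdb], ?_⟩
    obtain ⟨f, hf, hf'⟩ := exists_functional_of_notMem_range hna
    obtain ⟨f', hf1, hf1'⟩ := exists_functional_of_notMem_range hnb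
    rintro ⟨y, hy⟩
    have hzero : ∀ y, LinearMap.mul' ℂ ℂ (TensorProduct.map f f'
        ((TensorProduct.map d LinearMap.id + TensorProduct.map s d' :
          K ⊗[ℂ] L →ₗ[ℂ] K ⊗[ℂ] L) y)) = 0 := by
      intro y
      induction y using TensorProduct.induction_on with
      | zero => simp
      | tmul k l => simp [hf', hf1']
      | add y y' h h' => rw [map_add, map_add, map_add, h, h', add_zero]
    have := hzero y
    rw [hy] at this
    simp [hf, hf1] at this

theorem rTensor_equivFinsuppOfBasisRight_symm {K' ι : Type*} [AddCommGroup K'] [Module ℂ K']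
    [DecidableEq ι] (b : Module.Basis ι ℂ L) (f : K →ₗ[ℂ] K') (c : ι →₀ K) :
    f.rTensor L ((TensorProduct.equivFinsuppOfBasisRight b).symm c) =
      (TensorProduct.equivFinsuppOfBasisRight b).symm (c.mapRange f (map_zero f)) := by
  rw [TensorProduct.equivFinsuppOfBasisRight_symm_apply,
    TensorProduct.equivFinsuppOfBasisRight_symm_apply, Finsupp.sum_mapRange_index (by simp),
    map_finsuppSum]
  rfl

/-- A basis of `L` splits `K ⊗ L` into copies of `(K, d)`, with at least one copy since `L ≠ 0`. -/
theorem hasClass_rTensor_iff [Nontrivial L] (d : K →ₗ[ℂ] K) (S : Submodule ℂ K) :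
    HasClass (d.rTensor L) (LinearMap.range (S.subtype.rTensor L)) ↔ HasClass d S := by
  classical
  constructor
  · rintro ⟨_, ⟨t, rfl⟩, hdz, hn⟩
    by_contra hcon
    apply hn
    let b := Module.Basis.ofVectorSpace ℂ L
    obtain ⟨c, rfl⟩ := (TensorProduct.equivFinsuppOfBasisRight b).symm.surjective t
    rw [rTensor_equivFinsuppOfBasisRight_symm] at hdz ⊢
    have hd0 : ∀ k, d (c k) = 0 := by
      rw [rTensor_equivFinsuppOfBasisRight_symm, LinearEquiv.map_eq_zero_iff] at hdz
      intro k
      simpa using DFunLike.congr_fun hdz k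
    rw [TensorProduct.equivFinsuppOfBasisRight_symm_apply,
      Finsupp.sum_mapRange_index (by simp)]
    refine Submodule.sum_mem _ fun k _ => ?_
    have : (c k : K) ∈ LinearMap.range d := by
      by_contra hk
      exact hcon ⟨c k, (c k).2, hd0 k, hk⟩
    obtain ⟨y, hy⟩ := this
    exact ⟨y ⊗ₜ b k, by simp [hy]⟩
  · rintro ⟨a, ha, hda, hna⟩
    obtain ⟨v, hv⟩ := exists_ne (0 : L)
    obtain ⟨g, hg, -⟩ := Submodule.exists_le_ker_of_notMem 
      (show v ∉ (⊥ : Submodule ℂ L) from hv)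
    obtain ⟨f, hf, hf'⟩ := exists_functional_of_notMem_range hna
    refine ⟨a ⊗ₜ v, ⟨(⟨a, ha⟩ : S) ⊗ₜ v, rfl⟩, by simp [hda], ?_⟩
    rintro ⟨y, hy⟩
    have hzero : ∀ y, LinearMap.mul' ℂ ℂ (TensorProduct.map f g (d.rTensor L y)) = 0 := by
      intro y
      induction y using TensorProduct.induction_on with
      | zero => simp
      | tmul k l => simp [hf']
      | add y y' h h' => rw [map_add, map_add, map_add, h, h', add_zero]
    have := hzero y
    rw [hy] at this
    simp [hf, hg] at this

end Kunneth

/-! ### The twisted complex and depth-one resonance -/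

namespace CDGA

section Complex

variable (A : CDGA.{u}) {V : Type*} [AddCommGroup V] [Module ℂ V]

variable (V) in
/-- The degree `i` part of `A ⊗ V`. -/
def grTensor (i : ℕ) : Submodule ℂ (A ⊗[ℂ] V) := LinearMap.range (A.incl i V)

variable {A} in
theorem tmul_mem_grTensor {i : ℕ} {a : A} (ha : a ∈ A.gr i) (v : V) :
    a ⊗ₜ v ∈ A.grTensor V i := ⟨(⟨a, ha⟩ : A.gr i) ⊗ₜ v, rfl⟩

variable {A} in
theorem grTensor_induction {i : ℕ} {S : Submodule ℂ (A ⊗[ℂ] V)}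
    (h : ∀ a ∈ A.gr i, ∀ v : V, a ⊗ₜ v ∈ S) {x : A ⊗[ℂ] V} (hx : x ∈ A.grTensor V i) : x ∈ S := by
  obtain ⟨t, rfl⟩ := hx
  induction t using TensorProduct.induction_on with
  | zero => simp
  | tmul a v => exact h a a.2 v
  | add t t' ht ht' => rw [map_add]; exact S.add_mem ht ht'

theorem ext_tmul {W : Type*} [AddCommGroup W] [Module ℂ W] {f f' : A ⊗[ℂ] V →ₗ[ℂ] W}
    (h : ∀ i, ∀ a ∈ A.gr i, ∀ v : V, f (a ⊗ₜ v) = f' (a ⊗ₜ v)) : f = f' := by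
  refine TensorProduct.ext' fun a v => ?_
  exact eqOn_of_homogeneous (gr := A.gr) (f := f ∘ₗ (TensorProduct.mk ℂ A V).flip v)
    (f' := f' ∘ₗ (TensorProduct.mk ℂ A V).flip v) (fun i a ha => h i a ha v) a

variable (V) in
theorem exists_decompose_grTensor :
    ∃ D : A ⊗[ℂ] V →ₗ[ℂ] ⨁ i, A.grTensor V i, ∀ i (x : A.grTensor V i),
      D x = DirectSum.lof ℂ ℕ (fun i => A.grTensor V i) i x := by
  obtain ⟨F, hF⟩ := exists_linearMap_of_components A.gr (L := V →ₗ[ℂ] ⨁ i, A.grTensor V i)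
    fun i => TensorProduct.curry
      (DirectSum.lof ℂ ℕ (fun i => A.grTensor V i) i ∘ₗ (A.incl i V).rangeRestrict)
  refine ⟨TensorProduct.lift F, ?_⟩
  rintro i ⟨_, ⟨t, rfl⟩⟩
  refine LinearMap.congr_fun (f := TensorProduct.lift F ∘ₗ A.incl i V)
    (g := DirectSum.lof ℂ ℕ (fun i => A.grTensor V i) i ∘ₗ (A.incl i V).rangeRestrict)
    (TensorProduct.ext' fun a v => ?_) t
  exact LinearMap.congr_fun (hF i a) v

noncomputable instance : DirectSum.Decomposition (A.grTensor V) :=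
  DirectSum.Decomposition.ofLinearMap _ (A.exists_decompose_grTensor V).choose
    (by
      refine A.ext_tmul fun i a ha v => ?_
      rw [LinearMap.comp_apply, (A.exists_decompose_grTensor V).choose_spec i
        ⟨_, tmul_mem_grTensor ha v⟩]
      simp)
    (by
      ext i x : 2
      simpa using (A.exists_decompose_grTensor V).choose_spec i x)

end Complex

/-- Since `d` raises degree by one, a component of `d k` is `d` of the preceding component of `k`.
Hence a homogeneous element in the range bounds a homogeneous one, and in degree `0` it is zero. -/
theorem homogeneous_mem_range {K : Type*} [AddCommGroup K] [Module ℂ K]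
    {gr : ℕ → Submodule ℂ K} [DirectSum.Decomposition gr]
    {d : K →ₗ[ℂ] K} (hd : ∀ i, ∀ a ∈ gr i, d a ∈ gr (i + 1)) (k : K) :
    ((DirectSum.decompose gr (d k) 0 : gr 0) : K) = 0 ∧
      ∀ i, ((DirectSum.decompose gr (d k) (i + 1) : gr (i + 1)) : K) ∈ (gr i).map d := by
  induction k using DirectSum.Decomposition.inductionOn gr with
  | zero => simp
  | @homogeneous j a =>
    refine ⟨DirectSum.decompose_of_mem_ne _ (hd j a a.2) (by omega), fun i => ?_⟩
    by_cases hij : j = i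
    · subst hij
      rw [DirectSum.decompose_of_mem_same _ (hd j a a.2)]
      exact ⟨a, a.2, rfl⟩
    · rw [DirectSum.decompose_of_mem_ne _ (hd j a a.2) (by omega)]
      exact Submodule.zero_mem _
  | add a b ha hb =>
    refine ⟨by simp [ha.1, hb.1], fun i => ?_⟩
    simpa using Submodule.add_mem _ (ha.2 i) (hb.2 i)

section Resonance

variable (A : CDGA.{u}) {g : Type w} [LieRing g] [LieAlgebra ℂ g]
  {V : Type*} [AddCommGroup V] [Module ℂ V] (θ : g →ₗ⁅ℂ⁆ Module.End ℂ V)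

/-- The action of `A ⊗ g` on `A ⊗ V`. -/
noncomputable def act : A ⊗[ℂ] g →ₗ[ℂ] A ⊗[ℂ] V →ₗ[ℂ] A ⊗[ℂ] V :=
  TensorProduct.map₂ (LinearMap.mul ℂ A) (θ : g →ₗ[ℂ] Module.End ℂ V)

@[simp] theorem act_tmul (a b : A) (x : g) (v : V) :
    A.act θ (a ⊗ₜ x) (b ⊗ₜ v) = (a * b) ⊗ₜ θ x v := rfl

@[simp] theorem bracket_tmul (a b : A) (x y : g) :
    A.bracket g (a ⊗ₜ x) (b ⊗ₜ y) = (a * b) ⊗ₜ ⁅x, y⁆ := rfl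

@[simp] theorem incl_tmul {i : ℕ} (a : A.gr i) (x : V) :
    A.incl i V (a ⊗ₜ x) = (a : A) ⊗ₜ x := rfl

theorem covDeriv_mem (ω : A.gr 1 ⊗[ℂ] g) (i : ℕ) (t : A ⊗[ℂ] V) (ht : t ∈ A.grTensor V i) :
    A.covDeriv θ ω t ∈ A.grTensor V (i + 1) := by
  refine grTensor_induction (S := (A.grTensor V (i + 1)).comap (A.covDeriv θ ω)) ?_ ht
  intro a ha v
  refine Submodule.add_mem _ (tmul_mem_grTensor (A.d_mem i a ha) v) ?_
  change A.act θ (A.incl 1 g ω) (a ⊗ₜ v) ∈ _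
  induction ω using TensorProduct.induction_on with
  | zero => simp
  | tmul η x =>
    rw [add_comm i 1]
    exact tmul_mem_grTensor (SetLike.GradedMul.mul_mem η.2 ha) _
  | add ω ω' h h' => rw [map_add, map_add]; exact Submodule.add_mem _ h h'

theorem mem_resonance_one_iff (ω : A.gr 1 ⊗[ℂ] g) (i : ℕ) :
    ω ∈ A.resonance θ i 1 ↔
      ω ∈ A.flatConnections g ∧ HasClass (A.covDeriv θ ω) (A.grTensor V i) := by
  refine and_congr_right fun _ => ?_
  rw [Nat.cast_one, Cardinal.one_le_iff_pos, rank_pos_iff_nontrivial,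
    Submodule.Quotient.nontrivial_iff, Ne, Submodule.submoduleOf_eq_top, SetLike.not_le_iff_exists]
  have hmem : ∀ z ∈ A.grTensor V i,
      (z ∈ A.coboundaries θ ω i ↔ z ∈ LinearMap.range (A.covDeriv θ ω)) := by
    intro z hz
    constructor
    · intro h
      cases i with
      | zero =>
        rw [(Submodule.mem_bot ℂ).1 h]
        exact Submodule.zero_mem _
      | succ i =>
        obtain ⟨y, -, rfl⟩ := h
        exact ⟨y, rfl⟩
    · rintro ⟨k, rfl⟩
      have h := homogeneous_mem_range (A.covDeriv_mem θ ω) k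
      cases i with
      | zero =>
        rw [DirectSum.decompose_of_mem_same _ hz] at h
        rw [h.1]
        exact Submodule.zero_mem _
      | succ i =>
        have h2 := h.2 i
        rw [DirectSum.decompose_of_mem_same _ hz] at h2
        exact h2
  constructor
  · rintro ⟨z, ⟨hz, hdz⟩, hn⟩
    exact ⟨z, hz, hdz, fun h => hn ((hmem z hz).2 h)⟩
  · rintro ⟨z, hz, hdz, hn⟩
    exact ⟨z, ⟨hz, hdz⟩, fun h => hn ((hmem z hz).1 h)⟩

variable {A}

theorem covDeriv_apply (hd : A.d = 0) (ω : A.gr 1 ⊗[ℂ] g) (t : A ⊗[ℂ] V) :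
    A.covDeriv θ ω t = A.act θ (A.incl 1 g ω) t := by
  rw [covDeriv, hd]
  simp [act]

theorem mem_flatConnections_iff (hd : A.d = 0) (ω : A.gr 1 ⊗[ℂ] g) :
    ω ∈ A.flatConnections g ↔ A.bracket g (A.incl 1 g ω) (A.incl 1 g ω) = 0 := by
  simp [flatConnections, partialD, hd]

/-- Degree-one elements anticommute, so the sum of the two orders of action becomes a commutator in
`End V`, which `θ` identifies with the bracket. Taking `ω = ω'` shows that flatness gives `d_ω² =
0`. -/
theorem act_act (ω ω' : A.gr 1 ⊗[ℂ] g) (t : A ⊗[ℂ] V) :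
    A.act θ (A.incl 1 g ω) (A.act θ (A.incl 1 g ω') t) +
      A.act θ (A.incl 1 g ω') (A.act θ (A.incl 1 g ω) t) =
    A.act θ (A.bracket g (A.incl 1 g ω) (A.incl 1 g ω')) t := by
  induction ω using TensorProduct.induction_on with
  | zero => simp
  | add ω₁ ω₂ h h' =>
    simp only [map_add, LinearMap.add_apply] at h h' ⊢
    rw [← h, ← h']; abel
  | tmul a x =>
    induction ω' using TensorProduct.induction_on with
    | zero => simp
    | add ω₁ ω₂ h h' =>
      simp only [map_add, LinearMap.add_apply] at h h' ⊢
      rw [← h, ← h']; abel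
    | tmul b y =>
      induction t using TensorProduct.induction_on with
      | zero => simp
      | add t₁ t₂ h h' =>
        simp only [map_add] at h h' ⊢
        rw [← h, ← h']; abel
      | tmul c v =>
        have := A.graded_comm 1 1 b b.2 a a.2
        simp only [incl_tmul, act_tmul, bracket_tmul, ← mul_assoc, this, LieHom.map_lie,
          Ring.lie_def, LinearMap.sub_apply, Module.End.mul_apply, TensorProduct.tmul_sub]
        simp [TensorProduct.neg_tmul, sub_eq_add_neg]

theorem covDeriv_covDeriv (hd : A.d = 0) {ω : A.gr 1 ⊗[ℂ] g} (hω : ω ∈ A.flatConnections g)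
    (t : A ⊗[ℂ] V) : A.covDeriv θ ω (A.covDeriv θ ω t) = 0 := by
  have h := act_act θ ω ω t
  rw [(mem_flatConnections_iff hd ω).1 hω, map_zero, LinearMap.zero_apply, ← two_smul ℂ] at h
  rw [covDeriv_apply θ hd, covDeriv_apply θ hd]
  exact (smul_eq_zero.1 h).resolve_left two_ne_zero

end Resonance

end CDGA

/-! ### Degree one of the tensor product of connected algebras -/

namespace CDGA

theorem IsConnected.exists_eq_smul_one {A : CDGA.{u}} (hA : A.IsConnected) {a : A}
    (ha : a ∈ A.gr 0) : ∃ r : ℂ, a = r • (1 : A) := by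
  obtain ⟨r, rfl⟩ : a ∈ Set.range (algebraMap ℂ A) := by rw [hA.2]; exact ha
  exact ⟨r, Algebra.algebraMap_eq_smul_one r⟩

theorem IsConnected.one_ne_zero {A : CDGA.{u}} (hA : A.IsConnected) : (1 : A) ≠ 0 := by
  intro h
  exact _root_.one_ne_zero (hA.1 
    (by rw [map_one, map_zero, h] : algebraMap ℂ A 1 = algebraMap ℂ A 0))

section TensorStructure

variable {A : CDGA.{u}} {B : CDGA.{v}}

/-- The pure tensor `a ⊗ b` as an element of the cdga `A ⊗ B`. -/
noncomputable def pure (a : A) (b : B) : A.tensor B := tmul a b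

variable (A B) in
/-- The underlying vector space of `A ⊗ B` is the tensor product. -/
noncomputable def ofTensor : A ⊗[ℂ] B ≃ₗ[ℂ] A.tensor B := GradedTensorProduct.of ℂ A.gr B.gr

@[simp] theorem ofTensor_tmul (a : A) (b : B) : ofTensor A B (a ⊗ₜ b) = pure a b := rfl

@[simp] theorem ofTensor_symm_pure (a : A) (b : B) : (ofTensor A B).symm (pure a b) = a ⊗ₜ b :=
  rfl

theorem pure_mul_pure {j i : ℕ} (a : A) {b : B} (hb : b ∈ B.gr j) {a' : A} (ha' : a' ∈ A.gr i)
    (b' : B) : pure a b * pure a' b' = (-1 : ℂ) ^ (j * i) • pure (a * a') (b * b') :=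
  tmul_mul_tmul A B a hb ha' b'

theorem pure_mem {i j q : ℕ} (h : i + j = q) {a : A} (ha : a ∈ A.gr i) {b : B}
    (hb : b ∈ B.gr j) : pure a b ∈ (A.tensor B).gr q := tmul_mem h ha hb

theorem gr_tensor_induction {q : ℕ} {S : Submodule ℂ (A.tensor B)}
    (h : ∀ i j : ℕ, i + j = q → ∀ a ∈ A.gr i, ∀ b ∈ B.gr j, pure a b ∈ S)
    {x : A.tensor B} (hx : x ∈ (A.tensor B).gr q) : x ∈ S :=
  tensorGr_induction (A := A) (B := B) (S := S) h hx

theorem ext_pure {W : Type*} [AddCommGroup W] [Module ℂ W] {f f' : A.tensor B →ₗ[ℂ] W}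
    (h : ∀ i, ∀ a ∈ A.gr i, ∀ b : B, f (pure a b) = f' (pure a b)) : f = f' := by
  have h1 : f ∘ₗ (ofTensor A B).toLinearMap = f' ∘ₗ (ofTensor A B).toLinearMap :=
    A.ext_tmul fun i a ha b => h i a ha b
  refine LinearMap.ext fun x => ?_
  have := LinearMap.congr_fun h1 ((ofTensor A B).symm x)
  simpa using this

theorem ext_pure_tmul {V W : Type*} [AddCommGroup V] [Module ℂ V] [AddCommGroup W] [Module ℂ W]
    {f f' : A.tensor B ⊗[ℂ] V →ₗ[ℂ] W}
    (h : ∀ i, ∀ a ∈ A.gr i, ∀ (b : B) (v : V), f (pure a b ⊗ₜ v) = f' (pure a b ⊗ₜ v)) :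
    f = f' := by
  refine TensorProduct.ext' fun c v => ?_
  exact LinearMap.congr_fun (f := f ∘ₗ (TensorProduct.mk ℂ (A.tensor B) V).flip v)
    (g := f' ∘ₗ (TensorProduct.mk ℂ (A.tensor B) V).flip v)
    (ext_pure fun i a ha b => h i a ha b v) c

@[simp] theorem coe_inclLeft (a : A.gr 1) :
    ((inclLeft A B a : (A.tensor B).gr 1) : A.tensor B) = pure (a : A) 1 := rfl

@[simp] theorem coe_inclRight (b : B.gr 1) :
    ((inclRight A B b : (A.tensor B).gr 1) : A.tensor B) = pure 1 (b : B) := rfl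

theorem tensor_d_eq_zero (hA : A.d = 0) (hB : B.d = 0) : (A.tensor B).d = 0 := by
  change tensorD A B = 0
  rw [tensorD, hA, hB]
  simp

/-- Degree one is `A⁰ ⊗ B¹ + A¹ ⊗ B⁰`, and connectedness makes the degree-zero factors scalars. -/
theorem inclLeft_coprod_inclRight_surjective (hA : A.IsConnected) (hB : B.IsConnected) :
    Function.Surjective ((inclLeft A B).coprod (inclRight A B)) := by
  rintro ⟨x, hx⟩
  suffices h : x ∈ LinearMap.range
      (((A.tensor B).gr 1).subtype ∘ₗ (inclLeft A B).coprod (inclRight A B)) by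
    obtain ⟨y, hy⟩ := h
    exact ⟨y, Subtype.ext hy⟩
  refine gr_tensor_induction (fun i j hij a ha b hb => ?_) hx
  rcases i with _ | i
  · obtain rfl : j = 1 := by omega
    obtain ⟨r, rfl⟩ := hA.exists_eq_smul_one ha
    refine ⟨(0, r • ⟨b, hb⟩), ?_⟩
    simp only [LinearMap.comp_apply, LinearMap.coprod_apply, map_zero, zero_add, map_smul]
    exact (smul_tmul r (1 : A) b).symm
  · obtain rfl : i = 0 := by omega
    obtain rfl : j = 0 := by omega
    obtain ⟨r, rfl⟩ := hB.exists_eq_smul_one hb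
    refine ⟨(r • ⟨a, ha⟩, 0), ?_⟩
    simp only [LinearMap.comp_apply, LinearMap.coprod_apply, map_zero, add_zero, map_smul]
    exact (tmul_smul r a (1 : B)).symm

theorem addConn_surjective (hA : A.IsConnected) (hB : B.IsConnected)
    (g : Type w) [AddCommGroup g] [Module ℂ g] : Function.Surjective (addConn A B g) := by
  rw [← LinearMap.range_eq_top, eq_top_iff]
  rintro t -
  induction t using TensorProduct.induction_on with
  | zero => exact Submodule.zero_mem _
  | add t t' h h' => exact Submodule.add_mem _ h h'
  | tmul c x =>
    obtain ⟨⟨a, b⟩, rfl⟩ := inclLeft_coprod_inclRight_surjective hA hB c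
    refine ⟨(a ⊗ₜ x, b ⊗ₜ x), ?_⟩
    simp [addConn, TensorProduct.add_tmul]

end TensorStructure

/-! ### Commuting families and one-dimensional centralizers -/

section Functionals

/-- Contraction of `M ⊗ N` by a linear functional on `M`. -/
noncomputable def contract {M N : Type*} [AddCommGroup M] [Module ℂ M] [AddCommGroup N]
    [Module ℂ N] (f : M →ₗ[ℂ] ℂ) : M ⊗[ℂ] N →ₗ[ℂ] N :=
  (TensorProduct.lid ℂ N).toLinearMap ∘ₗ f.rTensor N

variable {M N : Type*} [AddCommGroup M] [Module ℂ M] [AddCommGroup N] [Module ℂ N]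

@[simp] theorem contract_tmul (f : M →ₗ[ℂ] ℂ) (m : M) (n : N) :
    contract f (m ⊗ₜ[ℂ] n) = f m • n := by
  simp [contract]

/-- The coefficients of `t` in a basis of `M` are its contractions by the coordinate functionals,
hence all multiples of `x`. -/
theorem eq_tmul_of_contract_mem_span (t : M ⊗[ℂ] N) (x : N)
    (h : ∀ f : M →ₗ[ℂ] ℂ, contract f t ∈ Submodule.span ℂ {x}) : ∃ η : M, t = η ⊗ₜ x := by
  classical
  let b := Module.Basis.ofVectorSpace ℂ M
  obtain ⟨c, rfl⟩ := (TensorProduct.equivFinsuppOfBasisLeft b).symm.surjective t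
  rw [TensorProduct.equivFinsuppOfBasisLeft_symm_apply] at h ⊢
  have hc : ∀ i, ∃ r : ℂ, r • x = c i := by
    intro i
    have h1 := h (b.coord i)
    rw [map_finsuppSum, Finsupp.sum, Finset.sum_eq_single i] at h1
    · simpa [Submodule.mem_span_singleton] using h1
    · intro j _ hj
      simp [hj]
    · intro hi
      simp [Finsupp.notMem_support_iff.1 hi]
  choose r hr using hc
  refine ⟨∑ i ∈ c.support, r i • b i, ?_⟩
  rw [TensorProduct.sum_tmul]
  exact Finset.sum_congr rfl fun i _ => by rw [TensorProduct.smul_tmul, hr]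

theorem exists_contract_ne_zero {t : M ⊗[ℂ] N} (ht : t ≠ 0) :
    ∃ f : M →ₗ[ℂ] ℂ, contract f t ≠ 0 := by
  by_contra! h
  obtain ⟨η, rfl⟩ := eq_tmul_of_contract_mem_span t 0 fun f => by simp [h f]
  simp at ht

/-- Two families that commute in a Lie algebra with one-dimensional centralizers are collinear. -/
theorem commuting_cases {P g : Type*} [AddCommGroup P] [Module ℂ P] [LieRing g] [LieAlgebra ℂ g]
    (hg : ∀ x y : g, x ≠ 0 → ⁅x, y⁆ = 0 → y ∈ Submodule.span ℂ {x})
    (ω : M ⊗[ℂ] g) (ω' : P ⊗[ℂ] g)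
    (h : ∀ (f : M →ₗ[ℂ] ℂ) (f' : P →ₗ[ℂ] ℂ), ⁅contract f ω, contract f' ω'⁆ = 0) :
    ω = 0 ∨ ω' = 0 ∨ ∃ (x : g) (η : M) (η' : P), ω = η ⊗ₜ x ∧ ω' = η' ⊗ₜ x := by
  by_cases h0 : ω = 0
  · exact Or.inl h0
  by_cases h0' : ω' = 0
  · exact Or.inr (Or.inl h0')
  obtain ⟨f, hf⟩ := exists_contract_ne_zero h0
  obtain ⟨f', hf'⟩ := exists_contract_ne_zero h0'
  have h1 : ∀ k, contract k ω' ∈ Submodule.span ℂ {contract f ω} :=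
    fun k => hg _ _ hf (h f k)
  have h2 : ∀ k, contract k ω ∈ Submodule.span ℂ {contract f' ω'} :=
    fun k => hg _ _ hf' (by rw [← lie_skew, h k f', neg_zero])
  -- All contractions of `ω'` lie on the line of `contract f ω`, and those of `ω` on the line of
  -- `contract f' ω'`. This inclusion puts both on the first line.
  have h3 : Submodule.span ℂ {contract f' ω'} ≤ Submodule.span ℂ {contract f ω} :=
    (Submodule.span_singleton_le_iff_mem _ _).2 (h1 f')
  obtain ⟨η, hη⟩ := eq_tmul_of_contract_mem_span ω _ fun k => h3 (h2 k)
  obtain ⟨η', hη'⟩ := eq_tmul_of_contract_mem_span ω' _ h1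
  exact Or.inr (Or.inr ⟨_, η, η', hη, hη'⟩)

theorem exists_extend_by_zero {K L : Type*} [AddCommGroup K] [Module ℂ K] [AddCommGroup L]
    [Module ℂ L] (gr : ℕ → Submodule ℂ K) [DirectSum.Decomposition gr] (k : ℕ)
    (f : gr k →ₗ[ℂ] L) :
    ∃ F : K →ₗ[ℂ] L, (∀ a : gr k, F a = f a) ∧ ∀ i ≠ k, ∀ a ∈ gr i, F a = 0 := by
  obtain ⟨F, hF⟩ := exists_linearMap_of_components gr
    (fun i => if h : i = k then f ∘ₗ (LinearEquiv.ofEq (gr i) (gr k) (by rw [h])).toLinearMap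
      else 0)
  refine ⟨F, fun a => ?_, fun i hi a ha => ?_⟩
  · rw [hF k a, dif_pos rfl]
    rfl
  · rw [hF i ⟨a, ha⟩, dif_neg hi]
    rfl

end Functionals

/-- A traceless matrix is given by three entries, and commuting says that the two entry vectors are
proportional. The factor is read off at a nonzero entry of `x`. -/
theorem mem_span_of_commute {x y : Matrix (Fin 2) (Fin 2) ℂ} (hx : x.trace = 0) (hy : y.trace = 0)
    (hx0 : x ≠ 0) (h : x * y = y * x) : ∃ r : ℂ, r • x = y := by
  have h00 := congrFun (congrFun h 0) 0
  have h01 := congrFun (congrFun h 0) 1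
  have h10 := congrFun (congrFun h 1) 0
  simp only [Matrix.mul_apply, Fin.sum_univ_two, Matrix.trace_fin_two] at h00 h01 h10 hx hy
  have ex : x 1 1 = - x 0 0 := by linear_combination hx
  have ey : y 1 1 = - y 0 0 := by linear_combination hy
  rw [ex, ey] at h01 h10
  by_cases h1 : x 0 0 = 0
  · by_cases h2 : x 0 1 = 0
    · by_cases h3 : x 1 0 = 0
      · exact absurd (by ext i j; fin_cases i <;> fin_cases j <;> simp [ex, h1, h2, h3]) hx0
      · refine ⟨y 1 0 / x 1 0, ?_⟩
        ext i j
        fin_cases i <;> fin_cases j <;> simp [ex, ey] <;> field_simp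
        all_goals first | grind
    · refine ⟨y 0 1 / x 0 1, ?_⟩
      ext i j
      fin_cases i <;> fin_cases j <;> simp [ex, ey] <;> field_simp
      all_goals first | grind
  · refine ⟨y 0 0 / x 0 0, ?_⟩
    ext i j
    fin_cases i <;> fin_cases j <;> simp [ex, ey] <;> field_simp
    all_goals first | grind

theorem mem_span_of_lie_eq_zero {g : Type w} [LieRing g] [LieAlgebra ℂ g]
    (hg : Nonempty (g ≃ₗ⁅ℂ⁆ sl2) ∨ Nonempty (g ≃ₗ⁅ℂ⁆ sol2)) (x y : g) (hx : x ≠ 0)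
    (h : ⁅x, y⁆ = 0) : y ∈ Submodule.span ℂ {x} := by
  obtain ⟨e, he, het⟩ : ∃ e : g →ₗ⁅ℂ⁆ Matrix (Fin 2) (Fin 2) ℂ, Function.Injective e ∧
      ∀ z, (e z).trace = 0 := by
    rcases hg with ⟨⟨e⟩⟩ | ⟨⟨e⟩⟩
    · exact ⟨sl2.incl.comp e.toLieHom, Subtype.val_injective.comp e.injective,
        fun z => (e z).2⟩
    · exact ⟨sol2.incl.comp e.toLieHom, Subtype.val_injective.comp e.injective,
        fun z => (e z).2.1⟩
  have h1 : e x * e y = e y * e x := by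
    rw [← sub_eq_zero, ← Ring.lie_def, ← LieHom.map_lie, h, map_zero]
  obtain ⟨r, hr⟩ := mem_span_of_commute (het x) (het y)
    (fun h0 => hx (he (by rw [h0, map_zero]))) h1
  exact Submodule.mem_span_singleton.2 ⟨r, he (by rw [map_smul, hr])⟩

end CDGA

/-! ### Flatness on the tensor product -/

namespace CDGA

section Flat

variable {A : CDGA.{u}} {B : CDGA.{v}} {g : Type w} [LieRing g] [LieAlgebra ℂ g]

variable (A B) in
/-- The bilinear map `(a, b) ↦ a ⊗ b`. -/
noncomputable def pureBilin : A →ₗ[ℂ] B →ₗ[ℂ] A.tensor B :=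
  (TensorProduct.mk ℂ A B).compr₂ (ofTensor A B).toLinearMap

@[simp] theorem pureBilin_apply (a : A) (b : B) : pureBilin A B a b = pure a b := rfl

/-- The bracket `[a ⊗ x, b ⊗ y] = (a ⊗ b) ⊗ [x, y]` of connections on the two factors. -/
noncomputable def crossBracket :
    A ⊗[ℂ] g →ₗ[ℂ] B ⊗[ℂ] g →ₗ[ℂ] A.tensor B ⊗[ℂ] g :=
  TensorProduct.map₂ (pureBilin A B) (LieModule.toEnd ℂ g g : g →ₗ[ℂ] Module.End ℂ g)

@[simp] theorem crossBracket_tmul (a : A) (b : B) (x y : g) :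
    crossBracket (a ⊗ₜ[ℂ] x) (b ⊗ₜ[ℂ] y) = pure a b ⊗ₜ[ℂ] ⁅x, y⁆ := rfl

theorem bracket_mem (ω ω' : A.gr 1 ⊗[ℂ] g) :
    A.bracket g (A.incl 1 g ω) (A.incl 1 g ω') ∈ A.grTensor g 2 := by
  induction ω using TensorProduct.induction_on with
  | zero => simp
  | add ω₁ ω₂ h h' => simpa using Submodule.add_mem _ h h'
  | tmul a x =>
    induction ω' using TensorProduct.induction_on with
    | zero => simp
    | add ω₁ ω₂ h h' => simpa using Submodule.add_mem _ h h'
    | tmul b y => exact tmul_mem_grTensor (SetLike.GradedMul.mul_mem a.2 b.2) _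

theorem bracket_inclLeft_inclLeft (ω₁ ω₂ : A.gr 1 ⊗[ℂ] g) :
    (A.tensor B).bracket g ((A.tensor B).incl 1 g ((inclLeft A B).rTensor g ω₁))
      ((A.tensor B).incl 1 g ((inclLeft A B).rTensor g ω₂)) =
      ((pureBilin A B).flip 1).rTensor g (A.bracket g (A.incl 1 g ω₁) (A.incl 1 g ω₂)) := by
  have h1B : (1 : B) ∈ B.gr 0 := SetLike.GradedOne.one_mem
  induction ω₁ using TensorProduct.induction_on with
  | zero => simp
  | add _ _ h h' => simp only [map_add, LinearMap.add_apply, h, h']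
  | tmul a x =>
    induction ω₂ using TensorProduct.induction_on with
    | zero => simp
    | add _ _ h h' => simp only [map_add, h, h']
    | tmul b y => simp [pure_mul_pure _ h1B b.2]

theorem bracket_inclRight_inclRight (ω₁' ω₂' : B.gr 1 ⊗[ℂ] g) :
    (A.tensor B).bracket g ((A.tensor B).incl 1 g ((inclRight A B).rTensor g ω₁'))
      ((A.tensor B).incl 1 g ((inclRight A B).rTensor g ω₂')) =
      (pureBilin A B 1).rTensor g (B.bracket g (B.incl 1 g ω₁') (B.incl 1 g ω₂')) := by
  have h1A : (1 : A) ∈ A.gr 0 := SetLike.GradedOne.one_mem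
  induction ω₁' using TensorProduct.induction_on with
  | zero => simp
  | add _ _ h h' => simp only [map_add, LinearMap.add_apply, h, h']
  | tmul a x =>
    induction ω₂' using TensorProduct.induction_on with
    | zero => simp
    | add _ _ h h' => simp only [map_add, h, h']
    | tmul b y => simp [pure_mul_pure _ a.2 h1A]

theorem bracket_inclLeft_inclRight (ω₁ : A.gr 1 ⊗[ℂ] g) (ω₂' : B.gr 1 ⊗[ℂ] g) :
    (A.tensor B).bracket g ((A.tensor B).incl 1 g ((inclLeft A B).rTensor g ω₁))
      ((A.tensor B).incl 1 g ((inclRight A B).rTensor g ω₂')) =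
      crossBracket (A.incl 1 g ω₁) (B.incl 1 g ω₂') := by
  have h1A : (1 : A) ∈ A.gr 0 := SetLike.GradedOne.one_mem
  have h1B : (1 : B) ∈ B.gr 0 := SetLike.GradedOne.one_mem
  induction ω₁ using TensorProduct.induction_on with
  | zero => simp
  | add _ _ h h' => simp only [map_add, LinearMap.add_apply, h, h']
  | tmul a x =>
    induction ω₂' using TensorProduct.induction_on with
    | zero => simp
    | add _ _ h h' => simp only [map_add, h, h']
    | tmul b y => simp [pure_mul_pure _ h1B h1A]

/-- The Koszul sign from swapping two degree-one elements cancels the sign from skew-symmetry of the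
Lie bracket, so the two cross terms of `[ω + ω', ω + ω']` add up. -/
theorem bracket_inclRight_inclLeft (ω₁' : B.gr 1 ⊗[ℂ] g) (ω₂ : A.gr 1 ⊗[ℂ] g) :
    (A.tensor B).bracket g ((A.tensor B).incl 1 g ((inclRight A B).rTensor g ω₁'))
      ((A.tensor B).incl 1 g ((inclLeft A B).rTensor g ω₂)) =
      crossBracket (A.incl 1 g ω₂) (B.incl 1 g ω₁') := by
  induction ω₁' using TensorProduct.induction_on with
  | zero => simp
  | add _ _ h h' => simp only [map_add, LinearMap.add_apply, h, h']
  | tmul b y =>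
    induction ω₂ using TensorProduct.induction_on with
    | zero => simp
    | add _ _ h h' => simp only [map_add, LinearMap.add_apply, h, h']
    | tmul a x =>
      simp only [LinearMap.rTensor_tmul, incl_tmul, coe_inclLeft, coe_inclRight, bracket_tmul,
        pure_mul_pure _ b.2 a.2, crossBracket_tmul, one_mul, mul_one]
      rw [← lie_skew, TensorProduct.tmul_neg, pow_one, neg_smul, one_smul,
        TensorProduct.neg_tmul, neg_neg]

theorem bracket_addConn (ω₁ ω₂ : A.gr 1 ⊗[ℂ] g) (ω₁' ω₂' : B.gr 1 ⊗[ℂ] g) :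
    (A.tensor B).bracket g ((A.tensor B).incl 1 g (addConn A B g (ω₁, ω₁')))
        ((A.tensor B).incl 1 g (addConn A B g (ω₂, ω₂'))) =
      ((pureBilin A B).flip 1).rTensor g (A.bracket g (A.incl 1 g ω₁) (A.incl 1 g ω₂)) +
      (crossBracket (A.incl 1 g ω₁) (B.incl 1 g ω₂') +
        crossBracket (A.incl 1 g ω₂) (B.incl 1 g ω₁')) +
      (pureBilin A B 1).rTensor g (B.bracket g (B.incl 1 g ω₁') (B.incl 1 g ω₂')) := by
  simp only [addConn, LinearMap.coprod_apply, map_add, LinearMap.add_apply,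
    bracket_inclLeft_inclLeft, bracket_inclRight_inclRight, bracket_inclLeft_inclRight,
    bracket_inclRight_inclLeft]
  abel

theorem rTensor_eq_zero_of_mem_grTensor {W : Type*} [AddCommGroup W] [Module ℂ W] {i : ℕ}
    {p : A →ₗ[ℂ] W} (hp : ∀ a ∈ A.gr i, p a = 0) {t : A ⊗[ℂ] g} (ht : t ∈ A.grTensor g i) :
    p.rTensor g t = 0 :=
  grTensor_induction (S := LinearMap.ker (p.rTensor g)) (fun a ha v => by simp [hp a ha]) ht

theorem rTensor_crossBracket_eq_zero {W : Type*} [AddCommGroup W] [Module ℂ W]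
    {p : A.tensor B →ₗ[ℂ] W} (hp : ∀ a ∈ A.gr 1, ∀ b ∈ B.gr 1, p (pure a b) = 0)
    (ω : A.gr 1 ⊗[ℂ] g) (ω' : B.gr 1 ⊗[ℂ] g) :
    p.rTensor g (crossBracket (A.incl 1 g ω) (B.incl 1 g ω')) = 0 := by
  induction ω using TensorProduct.induction_on with
  | zero => simp
  | add _ _ h h' => simp only [map_add, LinearMap.add_apply, h, h', add_zero]
  | tmul a x =>
    induction ω' using TensorProduct.induction_on with
    | zero => simp
    | add _ _ h h' => simp only [map_add, h, h', add_zero]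
    | tmul b y => simp [hp a a.2 b b.2]

theorem exists_augmentation (hA : A.IsConnected) :
    ∃ ε : A →ₗ[ℂ] ℂ, ε 1 = 1 ∧ ∀ i ≠ 0, ∀ a ∈ A.gr i, ε a = 0 := by
  have h1 : (⟨1, SetLike.GradedOne.one_mem⟩ : A.gr 0) ∉ (⊥ : Submodule ℂ (A.gr 0)) := fun h =>
    hA.one_ne_zero (congrArg Subtype.val ((Submodule.mem_bot ℂ).1 h))
  obtain ⟨f, hf, -⟩ := Submodule.exists_le_ker_of_notMem h1
  obtain ⟨F, hF, hF'⟩ := exists_extend_by_zero A.gr 0 ((f ⟨1, SetLike.GradedOne.one_mem⟩)⁻¹ • f)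
  refine ⟨F, ?_, hF'⟩
  have := hF ⟨1, SetLike.GradedOne.one_mem⟩
  rw [LinearMap.smul_apply, smul_eq_mul, inv_mul_cancel₀ hf] at this
  exact this

variable {ω : A.gr 1 ⊗[ℂ] g} {ω' : B.gr 1 ⊗[ℂ] g}

/-- Applying `id ⊗ ε`, with `ε` an augmentation of `B`, kills the components in `A¹ ⊗ B¹` and `1 ⊗
B²` and leaves `[ω, ω]`. -/
theorem flat_left (hB : B.IsConnected) (hdA : A.d = 0) (hdB : B.d = 0)
    (hflat : addConn A B g (ω, ω') ∈ (A.tensor B).flatConnections g) :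
    ω ∈ A.flatConnections g := by
  obtain ⟨ε, h1, h0⟩ := exists_augmentation hB
  let p : A.tensor B →ₗ[ℂ] A :=
    TensorProduct.lift ((LinearMap.lsmul ℂ A).flip.compl₂ ε) ∘ₗ (ofTensor A B).symm.toLinearMap
  have hp : ∀ a b, p (pure a b) = ε b • a := fun a b => rfl
  rw [mem_flatConnections_iff (tensor_d_eq_zero hdA hdB), bracket_addConn] at hflat
  rw [mem_flatConnections_iff hdA]
  have h := congrArg (p.rTensor g) hflat
  rw [map_add, map_add, map_add, ← LinearMap.rTensor_comp_apply, ← LinearMap.rTensor_comp_apply,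
    rTensor_crossBracket_eq_zero fun a _ b hb => by rw [hp, h0 1 one_ne_zero b hb, zero_smul],
    rTensor_eq_zero_of_mem_grTensor (i := 2) (fun b hb => by
      simp [hp, h0 2 two_ne_zero b hb]) (bracket_mem ω' ω')] at h
  have hid : p ∘ₗ (pureBilin A B).flip 1 = LinearMap.id := by
    ext a; simp [hp, h1]
  simpa [hid] using h

theorem flat_right (hA : A.IsConnected) (hdA : A.d = 0) (hdB : B.d = 0)
    (hflat : addConn A B g (ω, ω') ∈ (A.tensor B).flatConnections g) :
    ω' ∈ B.flatConnections g := by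
  obtain ⟨ε, h1, h0⟩ := exists_augmentation hA
  let p : A.tensor B →ₗ[ℂ] B :=
    TensorProduct.lift (LinearMap.lsmul ℂ B ∘ₗ ε) ∘ₗ (ofTensor A B).symm.toLinearMap
  have hp : ∀ a b, p (pure a b) = ε a • b := fun a b => rfl
  rw [mem_flatConnections_iff (tensor_d_eq_zero hdA hdB), bracket_addConn] at hflat
  rw [mem_flatConnections_iff hdB]
  have h := congrArg (p.rTensor g) hflat
  rw [map_add, map_add, map_add, ← LinearMap.rTensor_comp_apply, ← LinearMap.rTensor_comp_apply,
    rTensor_crossBracket_eq_zero fun a ha b _ => by rw [hp, h0 1 one_ne_zero a ha, zero_smul],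
    rTensor_eq_zero_of_mem_grTensor (i := 2) (fun a ha => by
      simp [hp, h0 2 two_ne_zero a ha]) (bracket_mem ω ω)] at h
  have hid : p ∘ₗ pureBilin A B 1 = LinearMap.id := by
    ext b; simp [hp, h1]
  simpa [hid] using h

/-- Functionals concentrated in degree one on both factors isolate the cross term, which occurs
twice in the flatness equation. -/
theorem lie_contract_eq_zero (hdA : A.d = 0) (hdB : B.d = 0)
    (hflat : addConn A B g (ω, ω') ∈ (A.tensor B).flatConnections g)
    (f : A.gr 1 →ₗ[ℂ] ℂ) (f' : B.gr 1 →ₗ[ℂ] ℂ) :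
    ⁅contract f ω, contract f' ω'⁆ = 0 := by
  obtain ⟨φ, h1, h0⟩ := exists_extend_by_zero A.gr 1 f
  obtain ⟨φ', h1', h0'⟩ := exists_extend_by_zero B.gr 1 f'
  let p : A.tensor B →ₗ[ℂ] ℂ :=
    LinearMap.mul' ℂ ℂ ∘ₗ TensorProduct.map φ φ' ∘ₗ (ofTensor A B).symm.toLinearMap
  have hp : ∀ a b, p (pure a b) = φ a * φ' b := fun a b => rfl
  have hcross : contract p (crossBracket (A.incl 1 g ω) (B.incl 1 g ω')) =
      ⁅contract f ω, contract f' ω'⁆ := by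
    clear hflat
    induction ω using TensorProduct.induction_on with
    | zero => simp
    | add _ _ h h' => simp only [map_add, LinearMap.add_apply, h, h', add_lie]
    | tmul a x =>
      induction ω' using TensorProduct.induction_on with
      | zero => simp
      | add _ _ h h' => simp only [map_add, h, h', lie_add]
      | tmul b y => simp [hp, h1, h1', smul_smul, mul_comm]
  rw [mem_flatConnections_iff (tensor_d_eq_zero hdA hdB), bracket_addConn] at hflat
  have h := congrArg (contract p) hflat
  rw [map_add, map_add, map_add, hcross, contract, LinearMap.comp_apply, LinearMap.comp_apply,
    ← LinearMap.rTensor_comp_apply, ← LinearMap.rTensor_comp_apply,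
    rTensor_eq_zero_of_mem_grTensor (i := 2) (fun a ha => by
      simp [hp, h0 2 (by norm_num) a ha]) (bracket_mem ω ω),
    rTensor_eq_zero_of_mem_grTensor (i := 2) (fun b hb => by
      simp [hp, h0' 2 (by norm_num) b hb]) (bracket_mem ω' ω'), map_zero,
    zero_add, add_zero, ← two_smul ℂ] at h
  exact (smul_eq_zero.1 h).resolve_left two_ne_zero

end Flat

end CDGA

/-! ### One of the two connections is zero -/

namespace CDGA

section FactorZero

variable {A : CDGA.{u}} {B : CDGA.{v}} {g : Type w} [LieRing g] [LieAlgebra ℂ g]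
  {V : Type*} [AddCommGroup V] [Module ℂ V]

variable (A B V) in
/-- The isomorphism `(A ⊗ B) ⊗ V ≃ A ⊗ (B ⊗ V)`. -/
noncomputable def assocLeft : A.tensor B ⊗[ℂ] V ≃ₗ[ℂ] A ⊗[ℂ] (B ⊗[ℂ] V) :=
  (ofTensor A B).symm.rTensor V ≪≫ₗ TensorProduct.assoc ℂ A B V

@[simp] theorem assocLeft_tmul (a : A) (b : B) (v : V) :
    assocLeft A B V (pure a b ⊗ₜ v) = a ⊗ₜ (b ⊗ₜ v) := rfl

variable (A B V) in
/-- The isomorphism `(A ⊗ B) ⊗ V ≃ (A ⊗ V) ⊗ B`. -/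
noncomputable def assocRight : A.tensor B ⊗[ℂ] V ≃ₗ[ℂ] (A ⊗[ℂ] V) ⊗[ℂ] B :=
  (ofTensor A B).symm.rTensor V ≪≫ₗ TensorProduct.rightComm ℂ A B V

@[simp] theorem assocRight_tmul (a : A) (b : B) (v : V) :
    assocRight A B V (pure a b ⊗ₜ v) = (a ⊗ₜ v) ⊗ₜ b := rfl

theorem hasClass_rTensor_grTensor_iff [Nontrivial V] (m : A →ₗ[ℂ] A) (i : ℕ) :
    HasClass (m.rTensor V) (A.grTensor V i) ↔ HasClass m (A.gr i) :=
  hasClass_rTensor_iff m (A.gr i)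

theorem map_assocLeft_grTensor (q : ℕ) :
    ((A.tensor B).grTensor V q).map (assocLeft A B V).toLinearMap =
      totalGr A.gr (B.grTensor V) q := by
  apply le_antisymm
  · rw [Submodule.map_le_iff_le_comap]
    refine fun z hz => grTensor_induction (fun c hc v => ?_) hz
    refine gr_tensor_induction (S := ((totalGr A.gr (B.grTensor V) q).comap
      (assocLeft A B V).toLinearMap).comap ((TensorProduct.mk ℂ (A.tensor B) V).flip v))
      (fun i j hij a ha b hb => ?_) hc
    exact Submodule.subset_span ⟨i, j, hij, a, ha, _, tmul_mem_grTensor hb v, rfl⟩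
  · refine Submodule.span_le.2 ?_
    rintro _ ⟨i, j, hij, a, ha, t, ht, rfl⟩
    refine grTensor_induction (S := (((A.tensor B).grTensor V q).map
      (assocLeft A B V).toLinearMap).comap (TensorProduct.mk ℂ A (B ⊗[ℂ] V) a))
      (fun b hb v => ?_) ht
    exact ⟨pure a b ⊗ₜ v, tmul_mem_grTensor (pure_mem hij ha hb) v, rfl⟩

theorem map_assocRight_grTensor (q : ℕ) :
    ((A.tensor B).grTensor V q).map (assocRight A B V).toLinearMap =
      totalGr (A.grTensor V) B.gr q := by
  apply le_antisymm
  · rw [Submodule.map_le_iff_le_comap]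
    refine fun z hz => grTensor_induction (fun c hc v => ?_) hz
    refine gr_tensor_induction (S := ((totalGr (A.grTensor V) B.gr q).comap
      (assocRight A B V).toLinearMap).comap ((TensorProduct.mk ℂ (A.tensor B) V).flip v))
      (fun i j hij a ha b hb => ?_) hc
    exact Submodule.subset_span ⟨i, j, hij, _, tmul_mem_grTensor ha v, b, hb, rfl⟩
  · refine Submodule.span_le.2 ?_
    rintro _ ⟨i, j, hij, t, ht, b, hb, rfl⟩
    refine grTensor_induction (S := (((A.tensor B).grTensor V q).map
      (assocRight A B V).toLinearMap).comap ((TensorProduct.mk ℂ (A ⊗[ℂ] V) B).flip b))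
      (fun a ha v => ?_) ht
    exact ⟨pure a b ⊗ₜ v, tmul_mem_grTensor (pure_mem hij ha hb) v, rfl⟩

theorem map_ofTensor_symm_gr (q : ℕ) :
    ((A.tensor B).gr q).map (ofTensor A B).symm.toLinearMap = totalGr A.gr B.gr q := by
  apply le_antisymm
  · rw [Submodule.map_le_iff_le_comap]
    refine fun z hz => gr_tensor_induction (fun i j hij a ha b hb => ?_) hz
    exact Submodule.subset_span ⟨i, j, hij, a, ha, b, hb, rfl⟩
  · refine Submodule.span_le.2 ?_
    rintro _ ⟨i, j, hij, a, ha, b, hb, rfl⟩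
    exact ⟨pure a b, pure_mem hij ha hb, rfl⟩

theorem exists_grading_involution {K : Type*} [AddCommGroup K] [Module ℂ K]
    (gr : ℕ → Submodule ℂ K) [DirectSum.Decomposition gr] :
    ∃ s : K →ₗ[ℂ] K, ∀ i, ∀ a ∈ gr i, s a = (-1 : ℂ) ^ i • a := by
  obtain ⟨s, hs⟩ := exists_linearMap_of_components gr fun i => (-1 : ℂ) ^ i • (gr i).subtype
  exact ⟨s, fun i a ha => hs i ⟨a, ha⟩⟩

variable (θ : g →ₗ⁅ℂ⁆ Module.End ℂ V)

theorem covDeriv_zero (hd : A.d = 0) : A.covDeriv θ 0 = 0 := by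
  ext1
  simp [covDeriv, hd]

/-- Regrouped as `A ⊗ (B ⊗ V)`, the complex is the tensor product of `(A, 0)` and `(B ⊗ V, d_ω')`.
The sign from moving `ω'` past `A` is `A.sgn`. Künneth yields a condition on `A`, not on `A ⊗ V`;
the two agree because `V ≠ 0`. -/
theorem hasClass_addConn_zero_left [Nontrivial V] (hdA : A.d = 0) (hdB : B.d = 0)
    (ω' : B.gr 1 ⊗[ℂ] g) (hω' : ω' ∈ B.flatConnections g) (q : ℕ) :
    HasClass ((A.tensor B).covDeriv θ (addConn A B g (0, ω'))) ((A.tensor B).grTensor V q) ↔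
      ∃ i j, i + j = q ∧ HasClass (A.covDeriv θ 0) (A.grTensor V i) ∧
        HasClass (B.covDeriv θ ω') (B.grTensor V j) := by
  have hcov : ∀ x, assocLeft A B V ((A.tensor B).covDeriv θ (addConn A B g (0, ω')) x) =
      (TensorProduct.map (0 : A →ₗ[ℂ] A) LinearMap.id + TensorProduct.map A.sgn
        (B.covDeriv θ ω') : A ⊗[ℂ] (B ⊗[ℂ] V) →ₗ[ℂ] A ⊗[ℂ] (B ⊗[ℂ] V)) (assocLeft A B V x) := by
    refine LinearMap.congr_fun (f := (assocLeft A B V).toLinearMap ∘ₗ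
      (A.tensor B).covDeriv θ (addConn A B g (0, ω'))) (g := (TensorProduct.map (0 : A →ₗ[ℂ] A)
        LinearMap.id + TensorProduct.map A.sgn (B.covDeriv θ ω')) ∘ₗ
        (assocLeft A B V).toLinearMap) (ext_pure_tmul fun i a ha b v => ?_)
    simp only [LinearMap.comp_apply, LinearEquiv.coe_coe, LinearMap.add_apply, assocLeft_tmul,
      TensorProduct.map_tmul, LinearMap.zero_apply, TensorProduct.zero_tmul, zero_add,
      sgn_of_mem A ha, covDeriv_apply θ (tensor_d_eq_zero hdA hdB), covDeriv_apply θ hdB]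
    clear hω'
    induction ω' using TensorProduct.induction_on with
    | zero => simp [addConn]
    | add ω₁ ω₂ h h' =>
      rw [← add_zero (0 : A.gr 1 ⊗[ℂ] g), ← Prod.mk_add_mk]
      simp only [map_add, LinearMap.add_apply, h, h', TensorProduct.tmul_add]
    | tmul η x => simp [addConn, pure_mul_pure _ η.2 ha, ← TensorProduct.smul_tmul']
  rw [hasClass_equiv (assocLeft A B V) hcov, map_assocLeft_grTensor, hasClass_tensor_iff A.gr 0
    (by simp) (by simp) (B.grTensor V) _ (B.covDeriv_mem θ ω') (covDeriv_covDeriv θ hdB hω') A.sgn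
    (fun i a ha => sgn_of_mem A ha), covDeriv_zero θ hdA]
  have h0 : ∀ i, HasClass (0 : A ⊗[ℂ] V →ₗ[ℂ] A ⊗[ℂ] V) (A.grTensor V i) ↔
      HasClass (0 : A →ₗ[ℂ] A) (A.gr i) := fun i => by
    rw [← hasClass_rTensor_grTensor_iff (V := V), LinearMap.rTensor_zero]
  simp only [h0]

/-- Here `V` goes with `A`, so the grouping is `(A ⊗ V) ⊗ B`. The involution `s` is multiplied by
the zero differential of `B` and enters only to match the Künneth statement. -/
theorem hasClass_addConn_zero_right [Nontrivial V] (hdA : A.d = 0) (hdB : B.d = 0)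
    (ω : A.gr 1 ⊗[ℂ] g) (hω : ω ∈ A.flatConnections g) (q : ℕ) :
    HasClass ((A.tensor B).covDeriv θ (addConn A B g (ω, 0))) ((A.tensor B).grTensor V q) ↔
      ∃ i j, i + j = q ∧ HasClass (A.covDeriv θ ω) (A.grTensor V i) ∧
        HasClass (B.covDeriv θ 0) (B.grTensor V j) := by
  obtain ⟨s, hs⟩ := exists_grading_involution (A.grTensor V)
  have hcov : ∀ x, assocRight A B V ((A.tensor B).covDeriv θ (addConn A B g (ω, 0)) x) =
      (TensorProduct.map (A.covDeriv θ ω) LinearMap.id + TensorProduct.map s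
        (0 : B →ₗ[ℂ] B) : (A ⊗[ℂ] V) ⊗[ℂ] B →ₗ[ℂ] (A ⊗[ℂ] V) ⊗[ℂ] B) (assocRight A B V x) := by
    refine LinearMap.congr_fun (f := (assocRight A B V).toLinearMap ∘ₗ
      (A.tensor B).covDeriv θ (addConn A B g (ω, 0))) (g := (TensorProduct.map (A.covDeriv θ ω)
        LinearMap.id + TensorProduct.map s 0) ∘ₗ
        (assocRight A B V).toLinearMap) (ext_pure_tmul fun i a ha b v => ?_)
    simp only [LinearMap.comp_apply, LinearEquiv.coe_coe, LinearMap.add_apply, assocRight_tmul,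
      TensorProduct.map_tmul, LinearMap.zero_apply, TensorProduct.tmul_zero, add_zero,
      LinearMap.id_apply, covDeriv_apply θ (tensor_d_eq_zero hdA hdB), covDeriv_apply θ hdA]
    clear hω
    induction ω using TensorProduct.induction_on with
    | zero => simp [addConn]
    | add ω₁ ω₂ h h' =>
      rw [← add_zero (0 : B.gr 1 ⊗[ℂ] g), ← Prod.mk_add_mk]
      simp only [map_add, LinearMap.add_apply, h, h', TensorProduct.add_tmul]
    | tmul η x =>
      simp [addConn, pure_mul_pure _ (SetLike.GradedOne.one_mem : (1 : B) ∈ B.gr 0) ha]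
  rw [hasClass_equiv (assocRight A B V) hcov, map_assocRight_grTensor, hasClass_tensor_iff
    (A.grTensor V) _ (A.covDeriv_mem θ ω) (covDeriv_covDeriv θ hdA hω) B.gr 0
    (by simp) (by simp) s hs, covDeriv_zero θ hdB]
  have h0 : ∀ i, HasClass (0 : B ⊗[ℂ] V →ₗ[ℂ] B ⊗[ℂ] V) (B.grTensor V i) ↔
      HasClass (0 : B →ₗ[ℂ] B) (B.gr i) := fun i => by
    rw [← hasClass_rTensor_grTensor_iff (V := V), LinearMap.rTensor_zero]
  simp only [h0]

end FactorZero

/-! ### Both connections on a common line -/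

section Line

variable {A : CDGA.{u}} {B : CDGA.{v}} {g : Type w} [LieRing g] [LieAlgebra ℂ g]
  {V : Type*} [AddCommGroup V] [Module ℂ V]

theorem mul_mul_self_eq_zero (η : A.gr 1) (a : A) : (η : A) * (η * a) = 0 := by
  have h := A.graded_comm 1 1 η η.2 η η.2
  rw [mul_one, pow_one, neg_smul, one_smul, eq_neg_iff_add_eq_zero, ← two_smul ℂ] at h
  rw [← mul_assoc, (smul_eq_zero.1 h).resolve_left two_ne_zero, zero_mul]

theorem mulLeft_mem (η : A.gr 1) (i : ℕ) (a : A) (ha : a ∈ A.gr i) :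
    LinearMap.mulLeft ℂ (η : A) a ∈ A.gr (i + 1) := by
  rw [add_comm]
  exact SetLike.GradedMul.mul_mem η.2 ha

/-- Multiplication by `η ⊗ 1 + 1 ⊗ η'` is the tensor product differential built from multiplication
by `η` and by `η'`, which square to zero. -/
theorem hasClass_mulLeft_tensor (η : A.gr 1) (η' : B.gr 1) (q : ℕ) :
    HasClass (LinearMap.mulLeft ℂ (pure (η : A) 1 + pure 1 (η' : B) : A.tensor B))
        ((A.tensor B).gr q) ↔
      ∃ i j, i + j = q ∧ HasClass (LinearMap.mulLeft ℂ (η : A)) (A.gr i) ∧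
        HasClass (LinearMap.mulLeft ℂ (η' : B)) (B.gr j) := by
  have hcov : ∀ x, (ofTensor A B).symm
      (LinearMap.mulLeft ℂ (pure (η : A) 1 + pure 1 (η' : B) : A.tensor B) x) =
      (TensorProduct.map (LinearMap.mulLeft ℂ (η : A)) LinearMap.id + TensorProduct.map A.sgn
        (LinearMap.mulLeft ℂ (η' : B)) : A ⊗[ℂ] B →ₗ[ℂ] A ⊗[ℂ] B) ((ofTensor A B).symm x) := by
    refine LinearMap.congr_fun (f := (ofTensor A B).symm.toLinearMap ∘ₗ
      LinearMap.mulLeft ℂ (pure (η : A) 1 + pure 1 (η' : B) : A.tensor B))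
      (g := (TensorProduct.map (LinearMap.mulLeft ℂ (η : A)) LinearMap.id +
        TensorProduct.map A.sgn (LinearMap.mulLeft ℂ (η' : B))) ∘ₗ
        (ofTensor A B).symm.toLinearMap) (ext_pure fun i a ha b => ?_)
    simp [add_mul, pure_mul_pure _ (SetLike.GradedOne.one_mem : (1 : B) ∈ B.gr 0) ha,
      pure_mul_pure _ η'.2 ha, sgn_of_mem A ha, ← TensorProduct.smul_tmul']
  rw [hasClass_equiv (ofTensor A B).symm hcov, map_ofTensor_symm_gr, hasClass_tensor_iff
    A.gr _ (mulLeft_mem η) (mul_mul_self_eq_zero η) B.gr _ (mulLeft_mem η')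
    (mul_mul_self_eq_zero η') A.sgn (fun i a ha => sgn_of_mem A ha)]

theorem covDeriv_tmul (hd : A.d = 0) (θ : g →ₗ⁅ℂ⁆ Module.End ℂ V) (η : A.gr 1) (x : g) :
    A.covDeriv θ (η ⊗ₜ x) = TensorProduct.map (LinearMap.mulLeft ℂ (η : A)) (θ x) := by
  refine TensorProduct.ext' fun a v => ?_
  rw [covDeriv_apply θ hd]
  simp

/-- The automorphism `e = 1 ⊗ T` commutes with `η ⊗ 1`, and the differential is their composite, so
it has the kernel and range of `η ⊗ 1`. -/
theorem hasClass_map_of_bijective [Nontrivial V] (η : A) (T : V →ₗ[ℂ] V)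
    (hT : Function.Bijective T) (i : ℕ) :
    HasClass (TensorProduct.map (LinearMap.mulLeft ℂ η) T) (A.grTensor V i) ↔
      HasClass (LinearMap.mulLeft ℂ η) (A.gr i) := by
  rw [← hasClass_rTensor_grTensor_iff (V := V)]
  let e := (LinearEquiv.ofBijective T hT).lTensor A
  have he : ∀ z, TensorProduct.map (LinearMap.mulLeft ℂ η) T z =
      (LinearMap.mulLeft ℂ η).rTensor V (e z) :=
    LinearMap.congr_fun (g := (LinearMap.mulLeft ℂ η).rTensor V ∘ₗ e.toLinearMap)
      (TensorProduct.ext' fun a v => rfl)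
  have he' : ∀ z, TensorProduct.map (LinearMap.mulLeft ℂ η) T z =
      e ((LinearMap.mulLeft ℂ η).rTensor V z) :=
    LinearMap.congr_fun (g := e.toLinearMap ∘ₗ (LinearMap.mulLeft ℂ η).rTensor V)
      (TensorProduct.ext' fun a v => rfl)
  refine exists_congr fun z => and_congr_right fun _ => and_congr ?_ (not_congr ?_)
  · rw [he', LinearEquiv.map_eq_zero_iff]
  · constructor
    · rintro ⟨y, rfl⟩
      exact ⟨e y, (he y).symm⟩
    · rintro ⟨y, rfl⟩
      exact ⟨e.symm y, by rw [he, e.apply_symm_apply]⟩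

/-- The right-hand side just says `A^i ≠ 0`. Given `a ≠ 0` in `A^i`, a kernel vector `v` of `T`
makes `a ⊗ v` a cocycle. If it bounds, then `η a = 0`, and `a ⊗ v'` with `v'` outside the range of
`T` is a cocycle that cannot bound. -/
theorem hasClass_map_of_not_injective [FiniteDimensional ℂ V] (η : A.gr 1) (T : V →ₗ[ℂ] V)
    (hT : ¬ Function.Injective T) (i : ℕ) :
    HasClass (TensorProduct.map (LinearMap.mulLeft ℂ (η : A)) T) (A.grTensor V i) ↔
      HasClass (LinearMap.mulLeft ℂ (0 : A)) (A.gr i) := by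
  constructor
  · rintro ⟨z, hz, -, hn⟩
    by_contra hcon
    apply hn
    have hz0 : z ∈ (⊥ : Submodule ℂ (A ⊗[ℂ] V)) := by
      refine grTensor_induction (fun a ha v => ?_) hz
      have : a = 0 := by
        by_contra h0
        refine hcon ⟨a, ha, by simp, ?_⟩
        rintro ⟨y, rfl⟩
        simp at h0
      rw [this, TensorProduct.zero_tmul]
      exact Submodule.zero_mem _
    rw [(Submodule.mem_bot ℂ).1 hz0]
    exact Submodule.zero_mem _
  · rintro ⟨a, ha, -, hn⟩
    by_contra hcon
    apply hn
    have hrange : ∀ z ∈ A.grTensor V i,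
        TensorProduct.map (LinearMap.mulLeft ℂ (η : A)) T z = 0 →
        z ∈ LinearMap.range (TensorProduct.map (LinearMap.mulLeft ℂ (η : A)) T) := by
      intro z hz hdz
      by_contra h
      exact hcon ⟨z, hz, hdz, h⟩
    -- pairing the second factor with a functional `f`
    have hpair : ∀ (f : V →ₗ[ℂ] ℂ) (y : A ⊗[ℂ] V), TensorProduct.rid ℂ A (f.lTensor A
        (TensorProduct.map (LinearMap.mulLeft ℂ (η : A)) T y)) =
        η * TensorProduct.rid ℂ A ((f ∘ₗ T).lTensor A y) := fun f y =>
      LinearMap.congr_fun (f := (TensorProduct.rid ℂ A).toLinearMap ∘ₗ f.lTensor A ∘ₗ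
          TensorProduct.map (LinearMap.mulLeft ℂ (η : A)) T)
        (g := LinearMap.mulLeft ℂ (η : A) ∘ₗ (TensorProduct.rid ℂ A).toLinearMap ∘ₗ
          (f ∘ₗ T).lTensor A)
        (TensorProduct.ext' fun a v => by simp) y
    obtain ⟨v, hv, hv0⟩ : ∃ v, T v = 0 ∧ v ≠ 0 := by
      by_contra! h
      exact hT ((injective_iff_map_eq_zero T).2 h)
    obtain ⟨f, hf, -⟩ := Submodule.exists_le_ker_of_notMem
      (show v ∉ (⊥ : Submodule ℂ V) from hv0)
    -- If `a ⊗ v` bounds, pairing with `f` makes `f v • a` a multiple of `η`, and `η² = 0`.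
    have hηa : (η : A) * a = 0 := by
      obtain ⟨y, hy⟩ := hrange (a ⊗ₜ v) (tmul_mem_grTensor ha v) (by simp [hv])
      have h := hpair f y
      rw [hy, LinearMap.lTensor_tmul, TensorProduct.rid_tmul] at h
      have h2 : (η : A) * (f v • a) = 0 := by rw [h, mul_mul_self_eq_zero]
      rw [mul_smul_comm] at h2
      exact (smul_eq_zero.1 h2).resolve_left hf
    -- Finite dimension is used here: not injective implies not surjective.
    obtain ⟨v', hv'⟩ : ∃ v', v' ∉ LinearMap.range T := by
      by_contra! h
      exact hT (LinearMap.injective_iff_surjective.2 h)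
    obtain ⟨f', hf', hf0'⟩ := exists_functional_of_notMem_range hv'
    obtain ⟨y, hy⟩ := hrange (a ⊗ₜ v') (tmul_mem_grTensor ha v') (by simp [hηa])
    -- Since `f' ∘ T = 0` and `f' v' = 1`, the pairing reads `a = η * 0`.
    have h := hpair f' y
    rw [hy, LinearMap.lTensor_tmul, TensorProduct.rid_tmul, hf', one_smul,
      show f' ∘ₗ T = 0 from LinearMap.ext hf0', LinearMap.lTensor_zero, LinearMap.zero_apply,
      map_zero, mul_zero] at h
    rw [h]
    exact Submodule.zero_mem _

theorem hasClass_addConn_tmul [FiniteDimensional ℂ V] [Nontrivial V] (hdA : A.d = 0)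
    (hdB : B.d = 0) (θ : g →ₗ⁅ℂ⁆ Module.End ℂ V) (η : A.gr 1) (η' : B.gr 1) (x : g) (q : ℕ) :
    HasClass ((A.tensor B).covDeriv θ (addConn A B g (η ⊗ₜ x, η' ⊗ₜ x)))
        ((A.tensor B).grTensor V q) ↔
      ∃ i j, i + j = q ∧ HasClass (A.covDeriv θ (η ⊗ₜ x)) (A.grTensor V i) ∧
        HasClass (B.covDeriv θ (η' ⊗ₜ x)) (B.grTensor V j) := by
  have hadd : addConn A B g (η ⊗ₜ x, η' ⊗ₜ x) = (inclLeft A B η + inclRight A B η') ⊗ₜ x := by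
    simp [addConn, TensorProduct.add_tmul]
  rw [hadd, covDeriv_tmul (tensor_d_eq_zero hdA hdB), covDeriv_tmul hdA, covDeriv_tmul hdB]
  by_cases hT : Function.Injective (θ x)
  · have hT' : Function.Bijective (θ x) := ⟨hT, LinearMap.injective_iff_surjective.1 hT⟩
    simp only [hasClass_map_of_bijective _ _ hT']
    exact hasClass_mulLeft_tensor η η' q
  · simp only [hasClass_map_of_not_injective _ _ hT]
    -- For singular `θ x` the claim is that `(A ⊗ B)^q ≠ 0` exactly when `A^i` and `B^j` are nonzero
    -- for some `i + j = q`: Künneth with zero differentials.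
    have h := hasClass_mulLeft_tensor (0 : A.gr 1) (0 : B.gr 1) q
    rw [show pure ((0 : A.gr 1) : A) 1 + pure 1 ((0 : B.gr 1) : B) = (0 : A.tensor B) by
      rw [← ofTensor_tmul, ← ofTensor_tmul]; simp] at h
    exact h

end Line

/-! ### Assembling the three cases -/

theorem hasClass_addConn_iff {A : CDGA.{u}} {B : CDGA.{v}} (hdA : A.d = 0) (hdB : B.d = 0)
    {g : Type w} [LieRing g] [LieAlgebra ℂ g]
    (hg : ∀ x y : g, x ≠ 0 → ⁅x, y⁆ = 0 → y ∈ Submodule.span ℂ {x})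
    {V : Type*} [AddCommGroup V] [Module ℂ V] [FiniteDimensional ℂ V] [Nontrivial V]
    (θ : g →ₗ⁅ℂ⁆ Module.End ℂ V) {ω : A.gr 1 ⊗[ℂ] g} {ω' : B.gr 1 ⊗[ℂ] g}
    (hω : ω ∈ A.flatConnections g) (hω' : ω' ∈ B.flatConnections g)
    (hflat : addConn A B g (ω, ω') ∈ (A.tensor B).flatConnections g) (q : ℕ) :
    HasClass ((A.tensor B).covDeriv θ (addConn A B g (ω, ω'))) ((A.tensor B).grTensor V q) ↔
      ∃ i j, i + j = q ∧ HasClass (A.covDeriv θ ω) (A.grTensor V i) ∧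
        HasClass (B.covDeriv θ ω') (B.grTensor V j) := by
  rcases commuting_cases hg ω ω' (lie_contract_eq_zero hdA hdB hflat) with
    rfl | rfl | ⟨x, η, η', rfl, rfl⟩
  · exact hasClass_addConn_zero_left θ hdA hdB ω' hω' q
  · exact hasClass_addConn_zero_right θ hdA hdB ω hω q
  · exact hasClass_addConn_tmul hdA hdB θ η η' x q

end CDGA

theorem mainTheorem2 (A : CDGA.{u}) (B : CDGA.{v}) (hA : A.IsConnected) (hB : B.IsConnected)
    (hdA : A.d = 0) (hdB : B.d = 0)
    (g : Type w) [LieRing g] [LieAlgebra ℂ g]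
    (hg : Nonempty (g ≃ₗ⁅ℂ⁆ sl2) ∨ Nonempty (g ≃ₗ⁅ℂ⁆ sol2))
    (V : Type*) [AddCommGroup V] [Module ℂ V] [FiniteDimensional ℂ V] [Nontrivial V]
    (θ : g →ₗ⁅ℂ⁆ Module.End ℂ V) (q : ℕ) :
    (A.tensor B).resonance θ q 1 =
      (CDGA.addConn A B g ''
        ⋃ (i : ℕ) (j : ℕ) (_ : i + j = q), A.resonance θ i 1 ×ˢ B.resonance θ j 1) ∩
      (A.tensor B).flatConnections g := by
  have hc := CDGA.mem_span_of_lie_eq_zero hg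
  ext Ω
  simp only [Set.mem_inter_iff, Set.mem_image, Set.mem_iUnion, Set.mem_prod,
    CDGA.mem_resonance_one_iff]
  constructor
  · rintro ⟨hflat, h⟩
    -- Only surjectivity of the identification of connections is needed; its injectivity plays no
    -- role.
    obtain ⟨⟨ω, ω'⟩, rfl⟩ := CDGA.addConn_surjective hA hB g Ω
    have hω := CDGA.flat_left hB hdA hdB hflat
    have hω' := CDGA.flat_right hA hdA hdB hflat
    obtain ⟨i, j, hij, h1, h2⟩ := (CDGA.hasClass_addConn_iff hdA hdB hc θ hω hω' hflat q).1 h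
    exact ⟨⟨(ω, ω'), ⟨i, j, hij, ⟨hω, h1⟩, ⟨hω', h2⟩⟩, rfl⟩, hflat⟩
  · rintro ⟨⟨⟨ω, ω'⟩, ⟨i, j, hij, ⟨hω, h1⟩, ⟨hω', h2⟩⟩, rfl⟩, hflat⟩
    exact ⟨hflat, (CDGA.hasClass_addConn_iff hdA hdB hc θ hω hω' hflat q).2
      ⟨i, j, hij, h1, h2⟩⟩
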